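/- Let $\mathbb{D} = \{x \in \mathbb{C} : |x| < 1\}$ be the Poincaré disk with the metric $g = \frac{4|dx|^2}{(1-|x|^2)^2}$ of curvature $-1$, and let $\Delta = \frac{(1-|x|^2)^2}{4}(\partial_{1}^2 + \partial_{2}^2)$ be its Laplace–Beltrami operator. For $x \in \mathbb{D}$ let $S_x\mathbb{D}$ be the unit circle of the tangent space at $x$, with its arc-length measure $dS_x$ (of total mass $2\pi$), and for $v \in S_x\mathbb{D}$ let $\gamma_{x,v}$ be the geodesic with $\gamma_{x,v}(0) = x$, $\dot\gamma_{x,v}(0) = v$. For $z \in \mathbb{C}$ put $$\Pi_0^{(z)} f(x) = \int_{S_x\mathbb{D}} \int_{\mathbb{R}} e^{-z|t|} f(\gamma_{x,v}(t))\,dt\,dS_x(v), \qquad S^{(z)} f(x) = \int_{S_x\mathbb{D}} \int_0^\infty e^{-(z+1)t} f(\gamma_{x,v}(t))\,dt\,dS_x(v).$$ Then for every complex-valued, compactly supported smooth function $f$ on $\mathbb{D}$ and every $z \in \mathbb{C}$ with $\operatorname{Re} z > 0$, the integrals defining $\Pi_0^{(z)} f$ and $S^{(z)} \Pi_0^{(z)}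 f$ converge absolutely at every point of $\mathbb{D}$, both functions are smooth on $\mathbb{D}$, $S^{(z)} \Pi_0^{(z)} f = \frac12 \Pi_0^{(z+1)} \Pi_0^{(z)} f$, and $$\bigl(\Delta - z(z+1)\bigr) S^{(z)} \Pi_0^{(z)} f = -8\pi^2 f \quad \text{on } \mathbb{D}.$$ -/

import Mathlib

open scoped ContDiff
open MeasureTheory Set Metric

noncomputable section

namespace PoincareDisk

/-- The open unit disk, as a subset of `ℂ`. -/
def disk : Set ℂ := ball 0 1

/-- The conformal factor `4 / (1 - |x|²)²` of the Poincaré metric. -/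
def conformalFactor (x : ℂ) : ℝ := 4 / (1 - ‖x‖ ^ 2) ^ 2

/-- The Poincaré metric `g = 4 |dz|² / (1 - |z|²)²`: the inner product of the tangent vectors
`v` and `w` at the point `x` of the disk. -/
def metric (x v w : ℂ) : ℝ := conformalFactor x * inner ℝ v w

/-- `γ : ℝ → ℂ` is a geodesic of the Poincaré disk: a smooth curve in the disk with `∇_{γ'} γ' = 0`.
The Levi-Civita connection is given in the coordinate of the disk by Koszul's formula
`2 g(∇_{γ'} γ', w) = 2 g(γ'', w) + 2 (∂_{γ'} g)(γ', w) - (∂_w g)(γ', γ')`. -/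
structure IsGeodesic (γ : ℝ → ℂ) : Prop where
  mem_disk : ∀ t, γ t ∈ disk
  smooth : ContDiff ℝ ∞ γ
  equation : ∀ (t : ℝ) (w : ℂ),
    2 * metric (γ t) (deriv (deriv γ) t) w
      + 2 * fderiv ℝ (fun y => metric y (deriv γ t) w) (γ t) (deriv γ t)
      - fderiv ℝ (fun y => metric y (deriv γ t) (deriv γ t)) (γ t) w = 0

theorem one_sub_pos {x : ℂ} (hx : x ∈ disk) : 0 < 1 - ‖x‖ ^ 2 := by
  have h : ‖x‖ < 1 := by simpa [disk] using hx
  nlinarith [norm_nonneg x]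

theorem hasFDerivAt_conformalFactor {x : ℂ} (hx : x ∈ disk) :
    HasFDerivAt conformalFactor ((16 / (1 - ‖x‖ ^ 2) ^ 3) • innerSL ℝ x) x := by
  have h0 := one_sub_pos hx
  have h1 : HasFDerivAt (fun y : ℂ => 1 - ‖y‖ ^ 2) (-(2 • innerSL ℝ x)) x :=
    ((hasStrictFDerivAt_norm_sq x).hasFDerivAt).const_sub 1
  have h2 : HasDerivAt (fun s : ℝ => 4 / s ^ 2) (-8 / (1 - ‖x‖ ^ 2) ^ 3) (1 - ‖x‖ ^ 2) := by
    have hne : (1 - ‖x‖ ^ 2) ^ 2 ≠ 0 := by positivity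
    have := ((hasDerivAt_const (1 - ‖x‖ ^ 2) (4 : ℝ)).fun_div
      ((hasDerivAt_id (1 - ‖x‖ ^ 2)).fun_pow 2) hne)
    refine this.congr_deriv ?_
    simp
    field_simp
    norm_num
  have h3 := h2.comp_hasFDerivAt x h1
  refine HasFDerivAt.congr_fderiv (f := conformalFactor) h3 ?_
  ext
  all_goals simp
  all_goals ring

/-- The geodesic equation in complex notation: `γ'' = - 2 (conj γ) γ'² / (1 - |γ|²)`. -/
theorem equation_iff {x : ℂ} (hx : x ∈ disk) (p q : ℂ) :
    (∀ w : ℂ, 2 * metric x q w + 2 * fderiv ℝ (fun y => metric y p w) x p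
      - fderiv ℝ (fun y => metric y p p) x w = 0) ↔
    q = -2 * (starRingEnd ℂ) x * p ^ 2 / ((1 - ‖x‖ ^ 2 : ℝ) : ℂ) := by
  have h0 := one_sub_pos hx
  have hd : ∀ a b : ℂ, fderiv ℝ (fun y => metric y a b) x
      = (inner ℝ a b) • ((16 / (1 - ‖x‖ ^ 2) ^ 3) • innerSL ℝ x) := fun a b =>
    ((hasFDerivAt_conformalFactor hx).mul_const (inner ℝ a b)).fderiv
  have hq : q = -2 * (starRingEnd ℂ) x * p ^ 2 / ((1 - ‖x‖ ^ 2 : ℝ) : ℂ) ↔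
      (q.re * (1 - ‖x‖ ^ 2) = (-2 * (starRingEnd ℂ) x * p ^ 2).re ∧
      q.im * (1 - ‖x‖ ^ 2) = (-2 * (starRingEnd ℂ) x * p ^ 2).im) := by
    rw [eq_div_iff (by exact_mod_cast h0.ne'), Complex.ext_iff, Complex.re_mul_ofReal,
      Complex.im_mul_ofReal]
  rw [hq]
  have key : ∀ w : ℂ, 2 * metric x q w + 2 * fderiv ℝ (fun y => metric y p w) x p
      - fderiv ℝ (fun y => metric y p p) x w =
      8 / (1 - ‖x‖ ^ 2) ^ 3 *
        ((q.re * (1 - ‖x‖ ^ 2) - (-2 * (starRingEnd ℂ) x * p ^ 2).re) * w.re +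
        (q.im * (1 - ‖x‖ ^ 2) - (-2 * (starRingEnd ℂ) x * p ^ 2).im) * w.im) := by
    intro w
    rw [hd, hd]
    have hp : inner ℝ p p = p.re ^ 2 + p.im ^ 2 := by
      rw [real_inner_self_eq_norm_sq, ← Complex.normSq_eq_norm_sq, Complex.normSq_apply]; ring
    rw [hp]
    simp only [metric, conformalFactor]
    generalize 1 - ‖x‖ ^ 2 = m at h0
    simp [Complex.inner, pow_two]
    field_simp
    ring
  have hpos : 0 < 8 / (1 - ‖x‖ ^ 2) ^ 3 := by positivity
  constructor
  · intro h
    have a := h 1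
    have b := h Complex.I
    rw [key] at a b
    simp only [Complex.one_re, Complex.one_im, Complex.I_re, Complex.I_im, mul_one, mul_zero,
      add_zero, zero_add, mul_eq_zero, hpos.ne', false_or] at a b
    exact ⟨by linarith, by linarith⟩
  · rintro ⟨a, b⟩ w
    rw [key, a, b]
    ring

/-- A geodesic is determined by its position and velocity at time `0`. -/
theorem geodesic_unique {γ δ : ℝ → ℂ} (hγ : IsGeodesic γ) (hδ : IsGeodesic δ)
    (h0 : γ 0 = δ 0) (h1 : deriv γ 0 = deriv δ 0) : γ = δ := by
  let V : ℂ × ℂ → ℂ × ℂ := fun p =>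
    (p.2, -2 * (starRingEnd ℂ) p.1 * p.2 ^ 2 / ((1 - ‖p.1‖ ^ 2 : ℝ) : ℂ))
  have hd : ∀ {γ : ℝ → ℂ}, IsGeodesic γ → ContDiff ℝ 1 (deriv γ) := fun hγ => by
    have h := hγ.smooth
    rw [contDiff_infty_iff_deriv] at h
    exact h.2.of_le (by exact_mod_cast le_top)
  have hsol : ∀ {γ : ℝ → ℂ}, IsGeodesic γ → ∀ t,
      HasDerivAt (fun t => (γ t, deriv γ t)) (V (γ t, deriv γ t)) t := by
    intro γ hγ t
    have e := (equation_iff (hγ.mem_disk t) (deriv γ t) (deriv (deriv γ) t)).1 (hγ.equation t)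
    have a : HasDerivAt γ (deriv γ t) t :=
      (hγ.smooth.differentiable (by norm_num) t).hasDerivAt
    have b : HasDerivAt (deriv γ) (deriv (deriv γ) t) t :=
      ((hd hγ).differentiable (by simp) t).hasDerivAt
    rw [e] at b
    exact a.prodMk b
  have hV : ContDiffOn ℝ 1 V (disk ×ˢ univ) := by
    intro p hp
    have hne : ((1 - ‖p.1‖ ^ 2 : ℝ) : ℂ) ≠ 0 := by exact_mod_cast (one_sub_pos hp.1).ne'
    refine ContDiffAt.contDiffWithinAt ?_
    refine contDiffAt_snd.prodMk ?_
    simp only [div_eq_mul_inv]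
    refine ContDiffAt.mul ?_ (ContDiffAt.inv ?_ hne)
    · exact (contDiffAt_const.mul (Complex.conjCLE.contDiff.contDiffAt.comp p contDiffAt_fst)).mul
        (contDiffAt_snd.pow 2)
    · exact Complex.ofRealCLM.contDiff.contDiffAt.comp p
        (contDiffAt_const.sub (contDiffAt_fst.norm_sq ℝ))
  funext t
  set s : Set (ℂ × ℂ) := (fun t => (γ t, deriv γ t)) '' Icc (-|t| - 1) (|t| + 1) ∪
    (fun t => (δ t, deriv δ t)) '' Icc (-|t| - 1) (|t| + 1) with hs
  have hcs : IsCompact s :=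
    (isCompact_Icc.image (hγ.smooth.continuous.prodMk (hd hγ).continuous)).union
      (isCompact_Icc.image (hδ.smooth.continuous.prodMk (hd hδ).continuous))
  have hopen : IsOpen (disk ×ˢ (univ : Set ℂ)) := isOpen_ball.prod isOpen_univ
  have hsub : s ⊆ disk ×ˢ univ := by
    rintro p (⟨r, -, rfl⟩ | ⟨r, -, rfl⟩)
    exacts [⟨hγ.mem_disk r, trivial⟩, ⟨hδ.mem_disk r, trivial⟩]
  have hlip : LocallyLipschitzOn s V := by
    intro p hp
    obtain ⟨K, u, hu, hK⟩ := (hV.contDiffAt (hopen.mem_nhds (hsub hp))).exists_lipschitzOnWith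
    exact ⟨K, u, mem_nhdsWithin_of_mem_nhds hu, hK⟩
  obtain ⟨K, hK⟩ := hlip.exists_lipschitzOnWith_of_compact hcs
  have ht : t ∈ Ioo (-|t| - 1) (|t| + 1) := ⟨by linarith [neg_abs_le t], by linarith [le_abs_self t]⟩
  have h00 : (0 : ℝ) ∈ Ioo (-|t| - 1) (|t| + 1) :=
    ⟨by linarith [abs_nonneg t], by linarith [abs_nonneg t]⟩
  have := ODE_solution_unique_of_mem_Ioo (v := fun _ => V) (s := fun _ => s) (K := K)
    (fun _ _ => hK) h00
    (f := fun t => (γ t, deriv γ t)) (g := fun t => (δ t, deriv δ t))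
    (fun r hr => ⟨hsol hγ r, Or.inl ⟨r, Ioo_subset_Icc_self hr, rfl⟩⟩)
    (fun r hr => ⟨hsol hδ r, Or.inr ⟨r, Ioo_subset_Icc_self hr, rfl⟩⟩)
    (by simp [h0, h1]) ht
  exact congrArg Prod.fst this


/-- Every unit vector `v = ((1 - |x|²) / 2) u`, `|u| = 1`, is the velocity of a geodesic. -/
theorem exists_geodesic {x u : ℂ} (hx : x ∈ disk) (hu : ‖u‖ = 1) :
    ∃ γ, IsGeodesic γ ∧ γ 0 = x ∧ deriv γ 0 = (((1 - ‖x‖ ^ 2) / 2 : ℝ) : ℂ) * u := by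
  have hx0 := one_sub_pos hx
  have hx1 : ‖x‖ < 1 := by simpa [disk] using hx
  let c : ℂ := (starRingEnd ℂ) x * u
  have hc : ‖c‖ = ‖x‖ := by simp [c, hu]
  -- `E t = e^t + 1 + c (e^t - 1)`, `N t = x (e^t + 1) + u (e^t - 1)`, and `γ = N / E`
  let E : ℝ → ℂ := fun t => ((Real.exp t + 1 : ℝ) : ℂ) + c * ((Real.exp t - 1 : ℝ) : ℂ)
  let N : ℝ → ℂ := fun t => x * ((Real.exp t + 1 : ℝ) : ℂ) + u * ((Real.exp t - 1 : ℝ) : ℂ)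
  have hE : ∀ t, E t ≠ 0 := by
    intro t h
    have h1 : ((Real.exp t + 1 : ℝ) : ℂ) = -(c * ((Real.exp t - 1 : ℝ) : ℂ)) := by
      linear_combination h
    have h2 := congrArg norm h1
    rw [norm_neg, norm_mul, hc, Complex.norm_real, Complex.norm_real, Real.norm_eq_abs,
      Real.norm_eq_abs, abs_of_pos (by positivity)] at h2
    have h3 : |Real.exp t - 1| < Real.exp t + 1 := by
      rw [abs_lt]; constructor <;> linarith [Real.exp_pos t]
    nlinarith [norm_nonneg x, abs_nonneg (Real.exp t - 1)]
  have huu : (starRingEnd ℂ) u * u = 1 := by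
    rw [mul_comm, Complex.mul_conj, Complex.normSq_eq_norm_sq, hu]; simp
  have hxx : (starRingEnd ℂ) x * x = ((‖x‖ ^ 2 : ℝ) : ℂ) := by
    rw [mul_comm, Complex.mul_conj, Complex.normSq_eq_norm_sq]
  have hEE : ∀ t, E t * (starRingEnd ℂ) (E t) - N t * (starRingEnd ℂ) (N t) =
      4 * (1 - ((‖x‖ ^ 2 : ℝ) : ℂ)) * ((Real.exp t : ℝ) : ℂ) := by
    intro t
    simp only [E, N, c, map_add, map_mul, Complex.conj_ofReal, Complex.conj_conj]
    rw [← hxx]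
    push_cast
    linear_combination ((starRingEnd ℂ) x * x * (Complex.exp t - 1) ^ 2 - (Complex.exp t - 1) ^ 2) * huu
  have hnorm : ∀ t, (((1 - ‖N t / E t‖ ^ 2 : ℝ)) : ℂ) =
      4 * (1 - ((‖x‖ ^ 2 : ℝ) : ℂ)) * ((Real.exp t : ℝ) : ℂ) / (E t * (starRingEnd ℂ) (E t)) := by
    intro t
    have h1 : ((‖N t / E t‖ ^ 2 : ℝ) : ℂ) =
        N t * (starRingEnd ℂ) (N t) / (E t * (starRingEnd ℂ) (E t)) := by
      rw [← Complex.normSq_eq_norm_sq, ← Complex.mul_conj, map_div₀]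
      field_simp
    have h2 : (starRingEnd ℂ) (E t) ≠ 0 := by simpa using hE t
    have h3 := hE t
    rw [← hEE, Complex.ofReal_sub, h1, Complex.ofReal_one]
    field_simp
  have hmem : ∀ t, N t / E t ∈ disk := by
    intro t
    have h1 := hnorm t
    rw [Complex.mul_conj] at h1
    have h2 : (1 - ‖N t / E t‖ ^ 2 : ℝ) =
      4 * (1 - (‖x‖ ^ 2 : ℝ)) * Real.exp t / Complex.normSq (E t) := by exact_mod_cast h1
    have h3 : 0 < Complex.normSq (E t) := Complex.normSq_pos.2 (hE t)
    have h4 : (0 : ℝ) < 1 - ‖N t / E t‖ ^ 2 := by rw [h2]; positivity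
    have : ‖N t / E t‖ < 1 := by nlinarith [norm_nonneg (N t / E t)]
    simpa [disk] using this
  have hexp : ∀ t : ℝ, HasDerivAt (fun t : ℝ => ((Real.exp t : ℝ) : ℂ)) ((Real.exp t : ℝ) : ℂ) t :=
    fun t => (Real.hasDerivAt_exp t).ofReal_comp
  have hE' : ∀ t, HasDerivAt E ((1 + c) * ((Real.exp t : ℝ) : ℂ)) t := by
    intro t
    have := ((hexp t).add_const 1).add (((hexp t).sub_const 1).const_mul c)
    refine (this.congr_deriv (by ring)).congr_of_eventuallyEq (.of_forall fun s => ?_)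
    simp [E]
  have hN' : ∀ t, HasDerivAt N ((x + u) * ((Real.exp t : ℝ) : ℂ)) t := by
    intro t
    have := (((hexp t).add_const 1).const_mul x).add (((hexp t).sub_const 1).const_mul u)
    refine (this.congr_deriv (by ring)).congr_of_eventuallyEq (.of_forall fun s => ?_)
    simp [N]
  have hd1 : deriv (fun t => N t / E t) = fun t =>
      2 * u * (1 - ((‖x‖ ^ 2 : ℝ) : ℂ)) * ((Real.exp t : ℝ) : ℂ) / E t ^ 2 := by
    funext t
    rw [((hN' t).fun_div (hE' t) (hE t)).deriv]
    congr 1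
    simp only [E, N, c]
    rw [← hxx]
    push_cast
    ring
  have hd2 : ∀ t, deriv (deriv (fun t => N t / E t)) t =
      2 * u * (1 - ((‖x‖ ^ 2 : ℝ) : ℂ)) * ((Real.exp t : ℝ) : ℂ) *
        (E t - 2 * (1 + c) * ((Real.exp t : ℝ) : ℂ)) / E t ^ 3 := by
    intro t
    rw [hd1, (((hexp t).const_mul _).fun_div ((hE' t).fun_pow 2) (pow_ne_zero 2 (hE t))).deriv]
    have := hE t
    simp
    field_simp
    try ring
  refine ⟨fun t => N t / E t, ⟨hmem, ?_, fun t => ?_⟩, ?_, ?_⟩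
  · have e : ContDiff ℝ ∞ (fun t : ℝ => ((Real.exp t : ℝ) : ℂ)) :=
      Complex.ofRealCLM.contDiff.comp Real.contDiff_exp
    simp only [div_eq_mul_inv]
    refine ContDiff.mul ?_ (ContDiff.inv ?_ hE)
    · simp only [N, Complex.ofReal_add, Complex.ofReal_sub]
      exact (contDiff_const.mul (e.add contDiff_const)).add
        (contDiff_const.mul (e.sub contDiff_const))
    · simp only [E, Complex.ofReal_add, Complex.ofReal_sub]
      exact (e.add contDiff_const).add (contDiff_const.mul (e.sub contDiff_const))
  · refine (equation_iff (hmem t) _ _).2 ?_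
    rw [hd2, hd1, hnorm, map_div₀]
    have h1 := hE t
    have h2 : (starRingEnd ℂ) (E t) ≠ 0 := by simpa using hE t
    have h3 : (1 - ((‖x‖ ^ 2 : ℝ) : ℂ)) ≠ 0 := by exact_mod_cast hx0.ne'
    have h4 : ((Real.exp t : ℝ) : ℂ) ≠ 0 := by exact_mod_cast (Real.exp_pos t).ne'
    have h5 : E t - 2 * (1 + c) * ((Real.exp t : ℝ) : ℂ) = - u * (starRingEnd ℂ) (N t) := by
      simp only [E, N, c, map_add, map_mul, Complex.conj_ofReal]
      push_cast
      linear_combination (Complex.exp t - 1) * huu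
    rw [h5]
    field_simp
    try ring
  · simp [N, E]
  · rw [hd1]
    simp [E]
    ring

/-- The geodesic `γ_{x,v}` with `γ_{x,v}(0) = x` and `γ_{x,v}'(0) = v`; for a unit vector `v` at a point `x`
of the disk it exists and is unique. -/
def geodesic (x v : ℂ) : ℝ → ℂ :=
  Classical.epsilon fun γ : ℝ → ℂ => IsGeodesic γ ∧ γ 0 = x ∧ deriv γ 0 = v

theorem geodesic_spec {x u : ℂ} (hx : x ∈ disk) (hu : ‖u‖ = 1) :
    IsGeodesic (geodesic x ((((1 - ‖x‖ ^ 2) / 2 : ℝ) : ℂ) * u)) ∧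
      geodesic x ((((1 - ‖x‖ ^ 2) / 2 : ℝ) : ℂ) * u) 0 = x ∧
      deriv (geodesic x ((((1 - ‖x‖ ^ 2) / 2 : ℝ) : ℂ) * u)) 0 =
        (((1 - ‖x‖ ^ 2) / 2 : ℝ) : ℂ) * u :=
  Classical.epsilon_spec (exists_geodesic hx hu)

/-- The geodesic flow `φ_t (x, v) = (γ_{x,v}(t), γ_{x,v}'(t))`. -/
def geodesicFlow (t : ℝ) (p : ℂ × ℂ) : ℂ × ℂ :=
  (geodesic p.1 p.2 t, deriv (geodesic p.1 p.2) t)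

/-- The measure `dS_x` on the unit circle `{v | g_x(v, v) = 1}`, regarded as a measure on the
tangent space `ℂ` at `x`: the arc length of the Euclidean metric `g_x`, i.e. `dθ` in the
parametrization `v = ((1 - |x|²) / 2) e^{iθ}`; its total mass is `2π`. -/
def fiberMeasure (x : ℂ) : Measure ℂ :=
  (volume.restrict (Ioc 0 (2 * Real.pi))).map
    fun θ : ℝ => (((1 - ‖x‖ ^ 2) / 2 : ℝ) : ℂ) * Complex.exp (θ * Complex.I)

/-- The pullback `π₀^*` of functions on the disk to functions on the unit tangent bundle. -/
def pullback (f : ℂ → ℂ) : ℂ × ℂ → ℂ := fun p => f p.1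

/-- The pushforward `π₀_*`: integration over the fibers of the unit tangent bundle. -/
def pushforward (u : ℂ × ℂ → ℂ) : ℂ → ℂ := fun x => ∫ v, u (x, v) ∂fiberMeasure x

/-- The attenuated operator `Π^{(z)} = ∫_ℝ e^{-|t| z} φ_t^* dt`. -/
def attenuatedPi (z : ℂ) (u : ℂ × ℂ → ℂ) : ℂ × ℂ → ℂ :=
  fun p => ∫ t : ℝ, Complex.exp (-((|t| : ℝ) : ℂ) * z) * u (geodesicFlow t p)

/-- The attenuated normal operator `Π₀^{(z)} = π₀_* Π^{(z)} π₀^*`. -/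
def normalOp (z : ℂ) (f : ℂ → ℂ) : ℂ → ℂ := pushforward (attenuatedPi z (pullback f))

/-- The operator
`S^{(z)} f (x) = ∫_{S_x} ∫_0^∞ e^{-(z + 1) t} f(γ_{x,v}(t)) dt dS_x(v)`. -/
def S (z : ℂ) (f : ℂ → ℂ) : ℂ → ℂ := fun x =>
  ∫ v, (∫ t in Ioi (0 : ℝ), Complex.exp (-(z + 1) * (t : ℂ)) * f (geodesic x v t)) ∂fiberMeasure x

/-- The Laplace-Beltrami operator of the conformal metric `g = 4 |dz|² / (1 - |z|²)²`,
`Δ_g u = ((1 - |z|²)² / 4) (∂_x² + ∂_y²) u`. -/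
def laplaceBeltrami (u : ℂ → ℂ) : ℂ → ℂ := fun x =>
  ((conformalFactor x)⁻¹ : ℝ) • Laplacian.laplacian u x

end PoincareDisk

end

/-! Write `P_z` for `polarOp z`, the integral of `f` against `e^{-zt} dt dθ` in geodesic polar
coordinates about `x`. Replacing `(t, v)` by `(-t, -v)` folds the full line onto the half line, so
on the disk `Π₀^{(z)} = 2 P_z` (`normalOp_eq_polarOp`) and `S^{(z)} = P_{z+1}` (`S_eq_polarOp`). The
claim becomes `(Δ - z(z+1)) P_{z+1} P_z f = -4π² f`.

Each `P_z` is convolution with a finite rotation-invariant complex measure on the hyperbolic plane.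
Such convolutions compose to one of the same kind (`conv_conv`), commute with each other
(`conv_prod_comm`) and commute with `Δ` on test functions (`laplaceBeltrami_conv`). It therefore
suffices to compute `D(z) = P_{z+1} P_z (Δ - z(z+1)) f`, which is `resolventDefect`.

The decisive point is the recurrence `P_z (Δ - z(z+1)) f = P_{z+2} (Δ - (z+1)(z+2)) f`
(`polarKernel_recurrence`). In polar coordinates `Δ = ∂_t² + coth t ∂_t + (sinh t)⁻² ∂_θ²`. The
angular term integrates to zero over circles. Since `(e^{-zt} - e^{-(z+2)t}) coth t = e^{-zt} +
e^{-(z+2)t}`, the difference of the two sides is the integral of the `t`-derivative of `(e^{-zt} -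
e^{-(z+2)t}) (∂_t f + (z+1) f)`, a function that vanishes at `0` and at infinity.

The recurrence and commutativity give `D(z+1) = P_{z+2} P_{z+1} (Δ - (z+1)(z+2)) f = P_{z+1} P_z (Δ
- z(z+1)) f = D(z)`. Along `z + n` the measure `e^{-zt} dt dθ` concentrates at `t = 0` with mass `2π
/ z`, so `P_z` approaches multiplication by `2π / z` and `D(z+n)` tends to `-4π² f`
(`norm_resolventDefect_add_le`). Being periodic, `D` equals its limit (`resolventDefect_eq_neg`).
The kernel of the composition never has to be computed. -/

noncomputable section

namespace PoincareDisk

open Filter Topology ComplexConjugate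

/-! ### Second derivatives along curves and the Euclidean Laplacian -/

/-- The chain rule along a curve, for the first derivative. -/
theorem hasDerivAt_comp_curve {g : ℂ → ℂ} {c : ℝ → ℂ} {c' : ℂ} {s : ℝ}
    (hg : ContDiffAt ℝ 2 g (c s)) (hc : HasDerivAt c c' s) :
    HasDerivAt (fun s => g (c s)) (fderiv ℝ g (c s) c') s :=
  (hg.differentiableAt (by norm_num)).hasFDerivAt.comp_hasDerivAt s hc

/-- The chain rule along a curve, for the second derivative. -/
theorem hasDerivAt_fderiv_comp_curve {g : ℂ → ℂ} {c c₁ : ℝ → ℂ} {c₂ : ℂ} {s : ℝ}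
    (hg : ContDiffAt ℝ 2 g (c s)) (hc : HasDerivAt c (c₁ s) s) (hc₁ : HasDerivAt c₁ c₂ s) :
    HasDerivAt (fun s => fderiv ℝ g (c s) (c₁ s))
      (fderiv ℝ (fderiv ℝ g) (c s) (c₁ s) (c₁ s) + fderiv ℝ g (c s) c₂) s := by
  have h1 : DifferentiableAt ℝ (fderiv ℝ g) (c s) :=
    (hg.fderiv_right (m := 1) (by norm_num)).differentiableAt (by norm_num)
  have h2 : HasDerivAt (fun s => fderiv ℝ g (c s)) (fderiv ℝ (fderiv ℝ g) (c s) (c₁ s)) s :=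
    h1.hasFDerivAt.comp_hasDerivAt s hc
  exact h2.clm_apply hc₁

theorem deriv_deriv_comp_curve {g : ℂ → ℂ} {c c₁ : ℝ → ℂ} {c₂ : ℂ} {s : ℝ}
    (hg : ContDiffAt ℝ 2 g (c s)) (hc : ∀ᶠ r in 𝓝 s, HasDerivAt c (c₁ r) r)
    (hc₁ : HasDerivAt c₁ c₂ s) :
    deriv (deriv fun s => g (c s)) s =
      fderiv ℝ (fderiv ℝ g) (c s) (c₁ s) (c₁ s) + fderiv ℝ g (c s) c₂ := by
  have h0 : ∀ᶠ r in 𝓝 s, ContDiffAt ℝ 2 g (c r) :=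
    hc.self_of_nhds.continuousAt.eventually (hg.eventually (by norm_num))
  have h1 : deriv (fun s => g (c s)) =ᶠ[𝓝 s] fun r => fderiv ℝ g (c r) (c₁ r) := by
    filter_upwards [h0, hc] with r hr hr' using (hasDerivAt_comp_curve hr hr').deriv
  rw [h1.deriv_eq]
  exact (hasDerivAt_fderiv_comp_curve hg hc.self_of_nhds hc₁).deriv

theorem hasDerivAt_line (x e : ℂ) (s : ℝ) : HasDerivAt (fun s : ℝ => x + s * e) e s := by
  simpa using ((Complex.ofRealCLM.hasDerivAt (x := s)).mul_const e).const_add x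

theorem hessian_eq_deriv_deriv {u : ℂ → ℂ} {x : ℂ} (hu : ContDiffAt ℝ 2 u x) (e : ℂ) :
    fderiv ℝ (fderiv ℝ u) x e e = deriv (deriv fun s : ℝ => u (x + s * e)) 0 := by
  rw [deriv_deriv_comp_curve (c := fun s : ℝ => x + s * e) (c₁ := fun _ => e) (c₂ := 0)
    (by simpa using hu) (.of_forall fun r => hasDerivAt_line x e r) (hasDerivAt_const _ _)]
  simp

theorem laplacian_eq_hessian (u : ℂ → ℂ) (x : ℂ) :
    Laplacian.laplacian u x = fderiv ℝ (fderiv ℝ u) x 1 1 +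
      fderiv ℝ (fderiv ℝ u) x Complex.I Complex.I := by
  rw [InnerProductSpace.laplacian_eq_iteratedFDeriv_complexPlane]
  simp [iteratedFDeriv_two_apply]

theorem hessian_expand {u : ℂ → ℂ} {x : ℂ} (hu : ContDiffAt ℝ 2 u x) (v : ℂ) :
    fderiv ℝ (fderiv ℝ u) x v v = v.re ^ 2 * fderiv ℝ (fderiv ℝ u) x 1 1 +
      2 * v.re * v.im * fderiv ℝ (fderiv ℝ u) x 1 Complex.I +
      v.im ^ 2 * fderiv ℝ (fderiv ℝ u) x Complex.I Complex.I := by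
  have hs : fderiv ℝ (fderiv ℝ u) x Complex.I 1 = fderiv ℝ (fderiv ℝ u) x 1 Complex.I :=
    (hu.isSymmSndFDerivAt (by simp)) _ _
  have hv : v = v.re • (1 : ℂ) + v.im • Complex.I := by
    conv_lhs => rw [← Complex.re_add_im v]
    simp
  generalize v.re = a at hv ⊢
  generalize v.im = b at hv ⊢
  subst hv
  simp only [map_add, map_smulₛₗ, add_apply, smul_apply, hs, RingHom.id_apply]
  simp only [Complex.real_smul]
  ring

/-- The Laplacian in an arbitrary conjugate pair of directions. -/
theorem hessian_add_hessian_I_mul {u : ℂ → ℂ} {x : ℂ} (hu : ContDiffAt ℝ 2 u x) (v : ℂ) :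
    fderiv ℝ (fderiv ℝ u) x v v + fderiv ℝ (fderiv ℝ u) x (Complex.I * v) (Complex.I * v) =
      (‖v‖ ^ 2 : ℝ) * Laplacian.laplacian u x := by
  rw [hessian_expand hu v, hessian_expand hu (Complex.I * v), laplacian_eq_hessian,
    ← Complex.normSq_eq_norm_sq, Complex.normSq_apply]
  simp
  ring

/-- The conformal change of variables for the Laplacian. -/
theorem laplacian_comp_holomorphic {u h h₁ : ℂ → ℂ} {h₂ x : ℂ}
    (hh : ∀ᶠ y in 𝓝 x, HasDerivAt h (h₁ y) y) (hh₁ : HasDerivAt h₁ h₂ x)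
    (hhs : ContDiffAt ℝ 2 h x) (hu : ContDiffAt ℝ 2 u (h x)) :
    Laplacian.laplacian (fun y => u (h y)) x =
      (‖h₁ x‖ ^ 2 : ℝ) * Laplacian.laplacian u (h x) := by
  have hline : ∀ e : ℂ, Tendsto (fun s : ℝ => x + s * e) (𝓝 0) (𝓝 x) := fun e => by
    have := (hasDerivAt_line x e 0).continuousAt.tendsto
    simpa using this
  have key : ∀ e : ℂ, fderiv ℝ (fderiv ℝ fun y => u (h y)) x e e =
      fderiv ℝ (fderiv ℝ u) (h x) (h₁ x * e) (h₁ x * e) + fderiv ℝ u (h x) (h₂ * e * e) := by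
    intro e
    rw [hessian_eq_deriv_deriv (u := fun y => u (h y)) (hu.comp x hhs) e,
      deriv_deriv_comp_curve (g := u) (c := fun s : ℝ => h (x + s * e))
        (c₁ := fun s : ℝ => h₁ (x + s * e) * e) (c₂ := h₂ * e * e) (by simpa using hu)]
    · simp
    · filter_upwards [(hline e).eventually hh] with r hr
      exact hr.comp_of_eq r (hasDerivAt_line x e r) rfl
    · exact (HasDerivAt.comp_of_eq (h₂ := h₁) (0 : ℝ) hh₁ (hasDerivAt_line x e 0)
        (by simp)).mul_const e
  rw [laplacian_eq_hessian, key, key, ← hessian_add_hessian_I_mul hu]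
  -- The first-order contributions of the directions `1` and `I` cancel because `h''` acts
  -- complex-linearly; this is what makes the Laplacian conformally covariant.
  have : h₂ * Complex.I * Complex.I = -(h₂ * 1 * 1) := by
    rw [mul_assoc, Complex.I_mul_I]; ring
  rw [this, map_neg, mul_one, mul_comm (h₁ x) Complex.I]
  ring

/-- A function that is smooth on an open set and vanishes off a compact subset is a smooth function
with compact support. -/
theorem contDiff_of_eq_zero_off_compact {V W : Type*} [NormedAddCommGroup V] [NormedSpace ℝ V]
    [NormedAddCommGroup W] [NormedSpace ℝ W] {u : V → W} {U C : Set V} (hU : IsOpen U)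
    (hC : IsCompact C) (hCU : C ⊆ U) (hu : ContDiffOn ℝ ∞ u U) (h0 : ∀ x, x ∉ C → u x = 0) :
    ContDiff ℝ ∞ u ∧ HasCompactSupport u ∧ tsupport u ⊆ C := by
  refine ⟨contDiff_iff_contDiffAt.2 fun x => ?_, HasCompactSupport.intro hC fun x hx => h0 x hx,
    closure_minimal (fun x hx => ?_) hC.isClosed⟩
  · by_cases hx : x ∈ C
    · exact hu.contDiffAt (hU.mem_nhds (hCU hx))
    · refine (contDiffAt_const (c := (0 : W))).congr_of_eventuallyEq ?_
      filter_upwards [hC.isClosed.isOpen_compl.mem_nhds hx] with y hy using h0 y hy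
  · by_contra h
    exact hx (h0 x h)

/-! ### Differentiation under the integral sign -/

section Parametric

variable {α : Type*} [MeasurableSpace α] {μ : Measure α} {ρ Y : α → ℂ}

theorem integrable_weight_mul_of_bounded {g : α → ℂ} (hρ : Integrable ρ μ)
    (hg : AEStronglyMeasurable g μ) {C : ℝ} (hC : ∀ a, ‖g a‖ ≤ C) :
    Integrable (fun a => ρ a * g a) μ :=
  hρ.mul_bdd hg (.of_forall hC)

/-- Compact support makes `H` and its derivative bounded uniformly in both variables, so constant
multiples of `‖ρ‖` dominate everything. -/
theorem hasFDerivAt_integral_comp {H : ℂ × ℂ → ℂ} (hρ : Integrable ρ μ) (hY : Measurable Y)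
    (hH : ContDiff ℝ ∞ H) (hHc : HasCompactSupport H) (x : ℂ) :
    HasFDerivAt (fun x => ∫ a, ρ a * H (x, Y a) ∂μ)
      (∫ a, ρ a • (fderiv ℝ H (x, Y a)).comp (ContinuousLinearMap.inl ℝ ℂ ℂ) ∂μ) x := by
  obtain ⟨C, hC⟩ := hHc.exists_bound_of_continuous hH.continuous
  have hH' : Continuous fun p => (fderiv ℝ H p).comp (ContinuousLinearMap.inl ℝ ℂ ℂ) :=
    (hH.continuous_fderiv (by norm_num)).clm_comp continuous_const
  have hH'c : HasCompactSupport fun p => (fderiv ℝ H p).comp (ContinuousLinearMap.inl ℝ ℂ ℂ) :=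
    (hHc.fderiv ℝ).comp_left (g := fun L : ℂ × ℂ →L[ℝ] ℂ => L.comp (ContinuousLinearMap.inl ℝ ℂ ℂ))
      (by simp)
  obtain ⟨C', hC'⟩ := hH'c.exists_bound_of_continuous hH'
  have hm : ∀ x, AEStronglyMeasurable (fun a => H (x, Y a)) μ := fun x =>
    (hH.continuous.measurable.comp (measurable_const.prodMk hY)).aestronglyMeasurable
  have hm' : AEStronglyMeasurable
      (fun a => (fderiv ℝ H (x, Y a)).comp (ContinuousLinearMap.inl ℝ ℂ ℂ)) μ :=
    (hH'.measurable.comp ((measurable_const (a := x)).prodMk hY)).aestronglyMeasurable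
  refine hasFDerivAt_integral_of_dominated_of_fderiv_le (bound := fun a => ‖ρ a‖ * C')
    (F' := fun x a => ρ a • (fderiv ℝ H (x, Y a)).comp (ContinuousLinearMap.inl ℝ ℂ ℂ))
    univ_mem (.of_forall fun x => ?_) ?_ ?_ ?_ ?_ ?_
  · exact hρ.aestronglyMeasurable.mul (hm x)
  · exact integrable_weight_mul_of_bounded hρ (hm x) fun a => hC _
  · exact hρ.aestronglyMeasurable.smul hm'
  · refine .of_forall fun a x _ => ?_
    rw [norm_smul]
    exact mul_le_mul_of_nonneg_left (hC' _) (norm_nonneg _)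
  · exact hρ.norm.mul_const C'
  · refine .of_forall fun a x _ => ?_
    have h1 : HasFDerivAt (fun x : ℂ => (x, Y a)) (ContinuousLinearMap.inl ℝ ℂ ℂ) x :=
      (hasFDerivAt_id x).prodMk (hasFDerivAt_const _ _)
    exact (((hH.differentiable (by norm_num)) (x, Y a)).hasFDerivAt.comp x h1).const_mul (ρ a)

/-- The derivative of `H` in its first variable, in the direction `e`. -/
def partialFst (e : ℂ) (H : ℂ × ℂ → ℂ) (p : ℂ × ℂ) : ℂ := fderiv ℝ H p (e, 0)

theorem contDiff_partialFst {H : ℂ × ℂ → ℂ} (hH : ContDiff ℝ ∞ H) (e : ℂ) :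
    ContDiff ℝ ∞ (partialFst e H) :=
  (hH.fderiv_right (by simp)).clm_apply contDiff_const

theorem hasCompactSupport_partialFst {H : ℂ × ℂ → ℂ} (hHc : HasCompactSupport H) (e : ℂ) :
    HasCompactSupport (partialFst e H) :=
  (hHc.fderiv ℝ).comp_left (g := fun L : ℂ × ℂ →L[ℝ] ℂ => L (e, 0)) (by simp)

theorem fderiv_integral_comp {H : ℂ × ℂ → ℂ} (hρ : Integrable ρ μ) (hY : Measurable Y)
    (hH : ContDiff ℝ ∞ H) (hHc : HasCompactSupport H) (x e : ℂ) :
    fderiv ℝ (fun x => ∫ a, ρ a * H (x, Y a) ∂μ) x e =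
      ∫ a, ρ a * partialFst e H (x, Y a) ∂μ := by
  rw [(hasFDerivAt_integral_comp hρ hY hH hHc x).fderiv, ContinuousLinearMap.integral_apply]
  · simp [partialFst]
  · have hH' : Continuous fun p => (fderiv ℝ H p).comp (ContinuousLinearMap.inl ℝ ℂ ℂ) :=
      (hH.continuous_fderiv (by norm_num)).clm_comp continuous_const
    have hH'c : HasCompactSupport fun p => (fderiv ℝ H p).comp (ContinuousLinearMap.inl ℝ ℂ ℂ) :=
      (hHc.fderiv ℝ).comp_left
        (g := fun L : ℂ × ℂ →L[ℝ] ℂ => L.comp (ContinuousLinearMap.inl ℝ ℂ ℂ)) (by simp)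
    obtain ⟨C', hC'⟩ := hH'c.exists_bound_of_continuous hH'
    exact hρ.smul_bdd C' (hH'.measurable.comp
      ((measurable_const (a := x)).prodMk hY)).aestronglyMeasurable (.of_forall fun a => hC' _)

theorem contDiff_integral_comp (hρ : Integrable ρ μ) (hY : Measurable Y) {H : ℂ × ℂ → ℂ}
    (hH : ContDiff ℝ ∞ H) (hHc : HasCompactSupport H) :
    ContDiff ℝ ∞ fun x => ∫ a, ρ a * H (x, Y a) ∂μ := by
  rw [contDiff_infty]
  intro n
  -- A directional derivative of the integral is an integral of the same shape with `partialFst e H`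
  -- in place of `H`, so the induction has to run over all `H` at once.
  induction n generalizing H with
  | zero =>
    have : Differentiable ℝ fun x => ∫ a, ρ a * H (x, Y a) ∂μ :=
      fun x => (hasFDerivAt_integral_comp hρ hY hH hHc x).differentiableAt
    simpa using this.continuous
  | succ n ih =>
    push_cast
    rw [contDiff_succ_iff_fderiv_apply]
    refine ⟨fun x => (hasFDerivAt_integral_comp hρ hY hH hHc x).differentiableAt, by simp, ?_⟩
    intro e
    simp only [fderiv_integral_comp hρ hY hH hHc]
    exact ih (contDiff_partialFst hH e) (hasCompactSupport_partialFst hHc e)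

theorem hessian_apply {u : ℂ → ℂ} {x : ℂ} (hu : ContDiffAt ℝ 2 u x) (e : ℂ) :
    fderiv ℝ (fderiv ℝ u) x e e = fderiv ℝ (fun y => fderiv ℝ u y e) x e := by
  rw [fderiv_clm_apply ((hu.fderiv_right (m := 1) (by norm_num)).differentiableAt (by norm_num))
    (differentiableAt_const e)]
  simp

theorem fderiv_slice {H : ℂ × ℂ → ℂ} (hH : ContDiff ℝ ∞ H) (x y e : ℂ) :
    fderiv ℝ (fun x => H (x, y)) x e = partialFst e H (x, y) := by
  have h1 : HasFDerivAt (fun x : ℂ => (x, y)) (ContinuousLinearMap.inl ℝ ℂ ℂ) x :=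
    (hasFDerivAt_id x).prodMk (hasFDerivAt_const _ _)
  have h2 := ((hH.differentiable (by norm_num)) (x, y)).hasFDerivAt.comp x h1
  rw [show (fun x => H (x, y)) = H ∘ fun x => (x, y) from rfl, h2.fderiv]
  simp [partialFst]

theorem integrable_weight_mul_comp {H : ℂ × ℂ → ℂ} (hρ : Integrable ρ μ) (hY : Measurable Y)
    (hH : ContDiff ℝ ∞ H) (hHc : HasCompactSupport H) (x : ℂ) :
    Integrable (fun a => ρ a * H (x, Y a)) μ := by
  obtain ⟨C, hC⟩ := hHc.exists_bound_of_continuous hH.continuous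
  exact integrable_weight_mul_of_bounded hρ (hH.continuous.measurable.comp
    (measurable_const.prodMk hY)).aestronglyMeasurable fun a => hC _

theorem laplacian_integral_comp (hρ : Integrable ρ μ) (hY : Measurable Y) {H : ℂ × ℂ → ℂ}
    (hH : ContDiff ℝ ∞ H) (hHc : HasCompactSupport H) (x : ℂ) :
    Laplacian.laplacian (fun x => ∫ a, ρ a * H (x, Y a) ∂μ) x =
      ∫ a, ρ a * Laplacian.laplacian (fun x => H (x, Y a)) x ∂μ := by
  have h2 : ContDiffAt ℝ 2 (fun x => ∫ a, ρ a * H (x, Y a) ∂μ) x :=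
    (contDiff_infty.1 (contDiff_integral_comp hρ hY hH hHc) 2).contDiffAt
  have h2' : ∀ y, ContDiffAt ℝ 2 (fun x => H (x, y)) x := fun y =>
    (contDiff_infty.1 (hH.comp (contDiff_id.prodMk contDiff_const)) 2).contDiffAt
  have h3 : ∀ e, ContDiff ℝ ∞ (partialFst e H) := contDiff_partialFst hH
  have h4 : ∀ e, HasCompactSupport (partialFst e H) := hasCompactSupport_partialFst hHc
  rw [laplacian_eq_hessian, hessian_apply h2, hessian_apply h2]
  simp only [laplacian_eq_hessian, hessian_apply (h2' _), fderiv_integral_comp hρ hY hH hHc,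
    fderiv_slice hH, fderiv_slice (h3 _), fderiv_integral_comp hρ hY (h3 _) (h4 _), mul_add]
  have hi := fun e => integrable_weight_mul_comp hρ hY (contDiff_partialFst (h3 e) e)
    (hasCompactSupport_partialFst (h4 e) e) x
  rw [integral_add (hi 1) (hi Complex.I)]

end Parametric

/-! ### Möbius isometries of the disk -/

/-- The isometry `y ↦ (x + y) / (1 + conj x * y)` of the disk, which maps `0` to `x`. -/
def mob (x y : ℂ) : ℂ := (x + y) / (1 + conj x * y)

theorem mem_disk_iff {x : ℂ} : x ∈ disk ↔ ‖x‖ < 1 := by simp [disk]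

theorem zero_mem_disk : (0 : ℂ) ∈ disk := by simp [disk]

theorem isOpen_disk : IsOpen disk := isOpen_ball

theorem mul_mem_disk {κ x : ℂ} (hκ : ‖κ‖ = 1) (hx : x ∈ disk) : κ * x ∈ disk := by
  rw [mem_disk_iff] at *
  simpa [hκ] using hx

theorem neg_mem_disk {x : ℂ} (hx : x ∈ disk) : -x ∈ disk := by
  rw [mem_disk_iff] at *
  simpa using hx

theorem one_add_conj_mul_ne_zero {x y : ℂ} (hx : x ∈ disk) (hy : y ∈ disk) :
    1 + conj x * y ≠ 0 := by
  rw [mem_disk_iff] at hx hy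
  intro h
  have h1 : ‖conj x * y‖ = 1 := by
    rw [eq_neg_of_add_eq_zero_right h]; simp
  rw [norm_mul, Complex.norm_conj] at h1
  nlinarith [norm_nonneg x, norm_nonneg y]

theorem conj_mul_self_of_norm_one {κ : ℂ} (hκ : ‖κ‖ = 1) : conj κ * κ = 1 := by
  rw [mul_comm, Complex.mul_conj, Complex.normSq_eq_norm_sq, hκ]; simp

theorem mob_zero_left (y : ℂ) : mob 0 y = y := by simp [mob]

theorem mob_zero_right (x : ℂ) : mob x 0 = x := by simp [mob]

theorem one_sub_norm_mob_sq {x y : ℂ} (hx : x ∈ disk) (hy : y ∈ disk) :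
    1 - ‖mob x y‖ ^ 2 = (1 - ‖x‖ ^ 2) * (1 - ‖y‖ ^ 2) / ‖1 + conj x * y‖ ^ 2 := by
  have h := one_add_conj_mul_ne_zero hx hy
  have h1 : ‖1 + conj x * y‖ ^ 2 ≠ 0 := by simpa using h
  rw [mob, norm_div, div_pow, eq_div_iff h1, sub_mul, div_mul_cancel₀ _ h1]
  simp only [← Complex.normSq_eq_norm_sq, Complex.normSq_apply]
  simp
  ring

theorem mob_mem {x y : ℂ} (hx : x ∈ disk) (hy : y ∈ disk) : mob x y ∈ disk := by
  have h1 := one_sub_norm_mob_sq hx hy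
  have h : 0 < ‖1 + conj x * y‖ := norm_pos_iff.2 (one_add_conj_mul_ne_zero hx hy)
  have h2 := one_sub_pos hx
  have h3 := one_sub_pos hy
  have : 0 < 1 - ‖mob x y‖ ^ 2 := by rw [h1]; positivity
  rw [mem_disk_iff]
  nlinarith [norm_nonneg (mob x y)]

theorem mul_mob {κ : ℂ} (hκ : ‖κ‖ = 1) (x y : ℂ) : κ * mob x y = mob (κ * x) (κ * y) := by
  have h : conj (κ * x) * (κ * y) = conj x * y := by
    rw [map_mul]; linear_combination (conj x * y) * conj_mul_self_of_norm_one hκ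
  rw [mob, mob, h]
  ring

theorem mob_mul {x y : ℂ} (hx : x ∈ disk) (hy : y ∈ disk) :
    mob x y * (1 + conj x * y) = x + y :=
  div_mul_cancel₀ _ (one_add_conj_mul_ne_zero hx hy)

theorem mob_neg_mob {x y : ℂ} (hx : x ∈ disk) (hy : y ∈ disk) : mob (-x) (mob x y) = y := by
  rw [mob, div_eq_iff (one_add_conj_mul_ne_zero (neg_mem_disk hx) (mob_mem hx hy)), map_neg]
  linear_combination mob_mul hx hy

theorem norm_one_add_div {x y : ℂ} (hx : x ∈ disk) (hy : y ∈ disk) :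
    ‖(1 + conj x * y) / (1 + x * conj y)‖ = 1 := by
  have h := one_add_conj_mul_ne_zero hx hy
  have : 1 + x * conj y = conj (1 + conj x * y) := by simp
  rw [this, norm_div, Complex.norm_conj, div_self (norm_ne_zero_iff.2 h)]

/-- The isometries `mob (mob x y)` and `mob x ∘ mob y` send `0` to the same point, so they differ by
a rotation about `0`. The operation `mob` is thus associative up to a rotation, depending on `x` and
`y` but not on `w`, and radial measures cannot see it. -/
theorem mob_mob {x y : ℂ} (hx : x ∈ disk) (hy : y ∈ disk) :
    ∃ κ : ℂ, ‖κ‖ = 1 ∧ ∀ w ∈ disk, mob (mob x y) w = mob x (mob y (κ * w)) := by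
  refine ⟨_, norm_one_add_div hx hy, fun w hw => ?_⟩
  have hκw := mul_mem_disk (norm_one_add_div hx hy) hw
  have h := one_add_conj_mul_ne_zero hx hy
  have h1 : 1 + x * conj y ≠ 0 := by
    simpa using (map_ne_zero (starRingEnd ℂ)).2 h
  have h2 := one_add_conj_mul_ne_zero (mob_mem hx hy) hw
  have h3 := one_add_conj_mul_ne_zero hy hκw
  have h4 := one_add_conj_mul_ne_zero hx (mob_mem hy hκw)
  rw [mob, mob.eq_1 x (mob y _), div_eq_div_iff h2 h4]
  set κ := (1 + conj x * y) / (1 + x * conj y) with hκ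
  have e1 : κ * (1 + x * conj y) = 1 + conj x * y := div_mul_cancel₀ _ h1
  have e2 := mob_mul hy hκw
  have e3 := mob_mul hx hy
  have e4 : conj (mob x y) * (1 + x * conj y) = conj x + conj y := by
    simpa using congrArg conj e3
  have e5 : (1 + conj x * mob y (κ * w)) * (1 + conj y * (κ * w)) =
      κ * (1 + x * conj y) * (1 + conj (mob x y) * w) := by
    linear_combination conj x * e2 - κ * w * e4 - e1
  have e6 : (x + mob y (κ * w)) * (1 + conj y * (κ * w)) =
      κ * (1 + x * conj y) * (mob x y + w) := by
    linear_combination e2 - e3 - mob x y * e1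
  refine mul_right_cancel₀ h3 ?_
  linear_combination (mob x y + w) * e5 - (1 + conj (mob x y) * w) * e6

/-- The numerators agree and the denominators are conjugate. This is the source of the commutativity
of radial convolutions. -/
theorem mob_comm_rot {x y : ℂ} (hx : x ∈ disk) (hy : y ∈ disk) :
    ∃ κ : ℂ, ‖κ‖ = 1 ∧ mob y x = κ * mob x y := by
  refine ⟨_, norm_one_add_div hx hy, ?_⟩
  have h := one_add_conj_mul_ne_zero hx hy
  have h1 : 1 + x * conj y ≠ 0 := by
    simpa using (map_ne_zero (starRingEnd ℂ)).2 h
  rw [div_mul_eq_mul_div, mul_comm (1 + _), mob_mul hx hy, mob, mul_comm (conj y) x, add_comm y x]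

theorem measurable_mob : Measurable fun p : ℂ × ℂ => mob p.1 p.2 := by
  unfold mob
  exact (measurable_fst.add measurable_snd).div
    (measurable_const.add ((Complex.continuous_conj.measurable.comp measurable_fst).mul
      measurable_snd))

theorem contDiffOn_mob : ContDiffOn ℝ ∞ (fun p : ℂ × ℂ => mob p.1 p.2) (disk ×ˢ disk) := by
  unfold mob
  simp only [div_eq_mul_inv]
  refine ContDiffOn.mul (contDiff_fst.add contDiff_snd).contDiffOn
    (ContDiffOn.inv (ContDiff.contDiffOn ?_) fun p hp => one_add_conj_mul_ne_zero hp.1 hp.2)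
  exact contDiff_const.add ((Complex.conjCLE.contDiff.comp contDiff_fst).mul contDiff_snd)

/-- The distance from `x` to `mob x y` is controlled by `y`. -/
theorem norm_mob_sub_le {x y : ℂ} (hx : x ∈ disk) (hy : y ∈ disk) : ‖mob x y - x‖ ≤ 2 * ‖y‖ := by
  have h := one_add_conj_mul_ne_zero hx hy
  have e : mob x y - x = y * ((1 - ‖x‖ ^ 2 : ℝ) : ℂ) / (1 + conj x * y) := by
    rw [mob, div_sub' h, ← Complex.normSq_eq_norm_sq]
    congr 1
    push_cast
    rw [← Complex.mul_conj]
    ring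
  have h1 : 1 - ‖x‖ ≤ ‖1 + conj x * y‖ := by
    have h2 : ‖(1 : ℂ)‖ - ‖-(conj x * y)‖ ≤ ‖1 - -(conj x * y)‖ := norm_sub_norm_le _ _
    rw [norm_one, norm_neg, norm_mul, Complex.norm_conj, sub_neg_eq_add] at h2
    rw [mem_disk_iff] at hy
    nlinarith [norm_nonneg x]
  have hx' := mem_disk_iff.1 hx
  have h0 : 0 < ‖1 + conj x * y‖ := norm_pos_iff.2 h
  rw [e, norm_div, norm_mul, Complex.norm_real, Real.norm_of_nonneg (one_sub_pos hx).le,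
    div_le_iff₀ h0]
  have h3 : 1 - ‖x‖ ^ 2 ≤ 2 * ‖1 + conj x * y‖ := by nlinarith [norm_nonneg x]
  nlinarith [norm_nonneg y]

/-! ### Convolution with radial measures -/

/-- A bounded Borel function on the plane. -/
structure BddMeas (g : ℂ → ℂ) : Prop where
  measurable : Measurable g
  bounded : ∃ C, ∀ y, ‖g y‖ ≤ C

theorem BddMeas.of_continuous {g : ℂ → ℂ} (hg : Continuous g) (hc : HasCompactSupport g) :
    BddMeas g :=
  ⟨hg.measurable, hc.exists_bound_of_continuous hg⟩

theorem BddMeas.comp {g T : ℂ → ℂ} (hg : BddMeas g) (hT : Measurable T) :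
    BddMeas fun y => g (T y) :=
  ⟨hg.measurable.comp hT, hg.bounded.imp fun _ hC _ => hC _⟩

theorem BddMeas.sub {g h : ℂ → ℂ} (hg : BddMeas g) (hh : BddMeas h) :
    BddMeas fun y => g y - h y := by
  obtain ⟨C, hC⟩ := hg.bounded
  obtain ⟨D, hD⟩ := hh.bounded
  exact ⟨hg.measurable.sub hh.measurable, C + D, fun y =>
    (norm_sub_le _ _).trans (add_le_add (hC y) (hD y))⟩

theorem BddMeas.const_mul {g : ℂ → ℂ} (hg : BddMeas g) (c : ℂ) : BddMeas fun y => c * g y := by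
  obtain ⟨C, hC⟩ := hg.bounded
  exact ⟨hg.measurable.const_mul c, ‖c‖ * C, fun y => by
    rw [norm_mul]; exact mul_le_mul_of_nonneg_left (hC y) (norm_nonneg _)⟩

theorem measurable_mob_right (x : ℂ) : Measurable (mob x) :=
  measurable_mob.comp (measurable_const.prodMk measurable_id)

/-- A finite complex measure on the disk that is invariant under rotations, presented as the
pushforward under `Y` of a measure with the integrable complex density `ρ`. -/
structure RadialKernel (Ω : Type) [MeasurableSpace Ω] where
  μ : Measure Ω
  sfinite : SFinite μ
  ρ : Ω → ℂ
  Y : Ω → ℂ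
  measurable_ρ : Measurable ρ
  integrable_ρ : Integrable ρ μ
  measurable_Y : Measurable Y
  mem_disk : ∀ a, Y a ∈ disk
  rot : ∀ g, BddMeas g → ∀ κ : ℂ, ‖κ‖ = 1 → ∫ a, ρ a * g (κ * Y a) ∂μ = ∫ a, ρ a * g (Y a) ∂μ

namespace RadialKernel

variable {Ω Ω' : Type} [MeasurableSpace Ω] [MeasurableSpace Ω']

instance (k : RadialKernel Ω) : SFinite k.μ := k.sfinite

/-- The convolution of a function with a radial measure on the hyperbolic plane. -/
def conv (k : RadialKernel Ω) (f : ℂ → ℂ) (x : ℂ) : ℂ := ∫ a, k.ρ a * f (mob x (k.Y a)) ∂k.μ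

theorem integrable (k : RadialKernel Ω) {g : ℂ → ℂ} (hg : BddMeas g) :
    Integrable (fun a => k.ρ a * g (k.Y a)) k.μ := by
  obtain ⟨C, hC⟩ := hg.bounded
  exact integrable_weight_mul_of_bounded k.integrable_ρ
    (hg.measurable.comp k.measurable_Y).aestronglyMeasurable fun a => hC _

theorem conv_eq_of_rot (k : RadialKernel Ω) {f : ℂ → ℂ} (hf : BddMeas f) (x : ℂ) {κ : ℂ}
    (hκ : ‖κ‖ = 1) : ∫ a, k.ρ a * f (mob x (κ * k.Y a)) ∂k.μ = k.conv f x :=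
  k.rot (fun y => f (mob x y)) (hf.comp (measurable_mob_right x)) κ hκ

theorem norm_conv_le (k : RadialKernel Ω) {f : ℂ → ℂ} {C : ℝ} (hC : ∀ y ∈ disk, ‖f y‖ ≤ C) {x : ℂ}
    (hx : x ∈ disk) : ‖k.conv f x‖ ≤ (∫ a, ‖k.ρ a‖ ∂k.μ) * C := by
  rw [← integral_mul_const]
  refine norm_integral_le_of_norm_le (k.integrable_ρ.norm.mul_const C) (.of_forall fun a => ?_)
  rw [norm_mul]
  exact mul_le_mul_of_nonneg_left (hC _ (mob_mem hx (k.mem_disk a))) (norm_nonneg _)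

theorem bddMeas_conv (k : RadialKernel Ω) {f : ℂ → ℂ} (hf : BddMeas f) : BddMeas (k.conv f) := by
  obtain ⟨C, hC⟩ := hf.bounded
  refine ⟨StronglyMeasurable.measurable ?_, (∫ a, ‖k.ρ a‖ ∂k.μ) * C, fun x => ?_⟩
  · refine StronglyMeasurable.integral_prod_right (f := fun x a => k.ρ a * f (mob x (k.Y a))) ?_
    refine Measurable.stronglyMeasurable ?_
    exact (k.measurable_ρ.comp measurable_snd).mul (hf.measurable.comp
      (measurable_mob.comp (measurable_fst.prodMk (k.measurable_Y.comp measurable_snd))))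
  · rw [← integral_mul_const]
    refine norm_integral_le_of_norm_le (k.integrable_ρ.norm.mul_const C) (.of_forall fun a => ?_)
    rw [norm_mul]
    exact mul_le_mul_of_nonneg_left (hC _) (norm_nonneg _)

theorem conv_sub (k : RadialKernel Ω) {f g : ℂ → ℂ} (hf : BddMeas f) (hg : BddMeas g) (x : ℂ) :
    k.conv (fun y => f y - g y) x = k.conv f x - k.conv g x := by
  simp only [conv, mul_sub]
  exact integral_sub (k.integrable (hf.comp (measurable_mob_right x)))
    (k.integrable (hg.comp (measurable_mob_right x)))

theorem conv_const_mul (k : RadialKernel Ω) (f : ℂ → ℂ) (c x : ℂ) :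
    k.conv (fun y => c * f y) x = c * k.conv f x := by
  simp only [conv, ← integral_const_mul]
  congr 1; ext a; ring

/-- Integration against a radial measure only sees the circular means. -/
theorem integral_eq_circular_mean (k : RadialKernel Ω) {g : ℂ → ℂ} (hg : BddMeas g) :
    (2 * Real.pi : ℂ) * ∫ a, k.ρ a * g (k.Y a) ∂k.μ =
      ∫ a, k.ρ a *
        (∫ θ in (0 : ℝ)..2 * Real.pi, g (Complex.exp (θ * Complex.I) * k.Y a)) ∂k.μ := by
  obtain ⟨C, hC⟩ := hg.bounded
  have h1 : ∫ θ in (0 : ℝ)..2 * Real.pi,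
        (∫ a, k.ρ a * g (Complex.exp (θ * Complex.I) * k.Y a) ∂k.μ) =
      (2 * Real.pi : ℂ) * ∫ a, k.ρ a * g (k.Y a) ∂k.μ := by
    simp only [fun θ : ℝ => k.rot g hg _ (Complex.norm_exp_ofReal_mul_I θ)]
    simp
  rw [← h1]
  simp only [intervalIntegral.integral_of_le Real.two_pi_pos.le, ← integral_const_mul]
  rw [integral_integral_swap]
  have hm : Measurable fun p : ℝ × Ω => g (Complex.exp (p.1 * Complex.I) * k.Y p.2) := by
    refine hg.measurable.comp (Measurable.mul ?_ (k.measurable_Y.comp measurable_snd))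
    exact (Continuous.measurable (by fun_prop : Continuous fun θ : ℝ =>
      Complex.exp (θ * Complex.I))).comp measurable_fst
  exact integrable_weight_mul_of_bounded (ρ := fun p : ℝ × Ω => k.ρ p.2)
    (k.integrable_ρ.comp_snd _) hm.aestronglyMeasurable fun p => hC _

theorem integrable_prod (k : RadialKernel Ω) (k' : RadialKernel Ω') {g : Ω × Ω' → ℂ}
    (hg : Measurable g) {C : ℝ} (hC : ∀ p, ‖g p‖ ≤ C) :
    Integrable (fun p => k.ρ p.1 * k'.ρ p.2 * g p) (k.μ.prod k'.μ) :=
  integrable_weight_mul_of_bounded (k.integrable_ρ.mul_prod k'.integrable_ρ)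
    hg.aestronglyMeasurable hC

theorem integral_prod_eq (k : RadialKernel Ω) (k' : RadialKernel Ω') {f : ℂ → ℂ} (hf : BddMeas f)
    {T : Ω × Ω' → ℂ} (hT : Measurable T) :
    ∫ p, k.ρ p.1 * k'.ρ p.2 * f (T p) ∂(k.μ.prod k'.μ) =
      ∫ a, k.ρ a * (∫ b, k'.ρ b * f (T (a, b)) ∂k'.μ) ∂k.μ := by
  obtain ⟨C, hC⟩ := hf.bounded
  refine (integral_prod _ (integrable_prod k k' (hf.measurable.comp hT) fun p => hC _)).trans ?_
  simp only [Function.comp, mul_assoc, integral_const_mul]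

theorem measurable_mob_prod (k : RadialKernel Ω) (k' : RadialKernel Ω') :
    Measurable fun p : Ω × Ω' => mob (k.Y p.1) (k'.Y p.2) :=
  measurable_mob.comp ((k.measurable_Y.comp measurable_fst).prodMk
    (k'.measurable_Y.comp measurable_snd))

/-- The convolution of two radial measures. -/
def prod (k : RadialKernel Ω) (k' : RadialKernel Ω') : RadialKernel (Ω × Ω') where
  μ := k.μ.prod k'.μ
  sfinite := inferInstance
  ρ := fun p => k.ρ p.1 * k'.ρ p.2
  Y := fun p => mob (k.Y p.1) (k'.Y p.2)
  measurable_ρ := (k.measurable_ρ.comp measurable_fst).mul (k'.measurable_ρ.comp measurable_snd)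
  integrable_ρ := k.integrable_ρ.mul_prod k'.integrable_ρ
  measurable_Y := measurable_mob_prod k k'
  mem_disk := fun p => mob_mem (k.mem_disk _) (k'.mem_disk _)
  rot := by
    intro g hg κ hκ
    rw [integral_prod_eq k k' hg (measurable_mob_prod k k'),
      integral_prod_eq k k' hg ((measurable_mob_prod k k').const_mul κ)]
    simp only [mul_mob hκ, k'.conv_eq_of_rot hg _ hκ]
    exact k.rot _ (k'.bddMeas_conv hg) κ hκ

/-- The rotation by which `mob` fails to be associative depends only on `x` and the first
integration variable, so invariance of the inner measure absorbs it. -/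
theorem conv_conv (k : RadialKernel Ω) (k' : RadialKernel Ω') {f : ℂ → ℂ} (hf : BddMeas f) {x : ℂ}
    (hx : x ∈ disk) : k.conv (k'.conv f) x = (k.prod k').conv f x := by
  refine Eq.trans ?_ (integral_prod_eq k k' hf
    ((measurable_mob_right x).comp (measurable_mob_prod k k'))).symm
  refine integral_congr_ae (.of_forall fun a => ?_)
  obtain ⟨κ, hκ, h⟩ := mob_mob hx (k.mem_disk a)
  simp only [Function.comp, conv, h _ (k'.mem_disk _)]
  congr 1
  exact k'.conv_eq_of_rot (f := fun y => f (mob x y)) (hf.comp (measurable_mob_right x)) _ hκ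

theorem circular_mean_rot (g : ℂ → ℂ) {κ : ℂ} (hκ : ‖κ‖ = 1) (y : ℂ) :
    ∫ θ in (0 : ℝ)..2 * Real.pi, g (Complex.exp (θ * Complex.I) * (κ * y)) =
      ∫ θ in (0 : ℝ)..2 * Real.pi, g (Complex.exp (θ * Complex.I) * y) := by
  obtain ⟨s, rfl⟩ : ∃ s : ℝ, Complex.exp (s * Complex.I) = κ := ⟨κ.arg, by
    have := Complex.norm_mul_exp_arg_mul_I κ
    simpa [hκ] using this⟩
  have hp : Function.Periodic (fun θ : ℝ => g (Complex.exp (θ * Complex.I) * y))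
      (2 * Real.pi) := by
    intro θ
    have : Complex.exp ((θ + 2 * Real.pi) * Complex.I) = Complex.exp (θ * Complex.I) := by
      rw [add_mul, Complex.exp_periodic]
    simp [this]
  have h := hp.intervalIntegral_add_eq s 0
  rw [zero_add, add_comm s] at h
  rw [← h]
  have h2 := intervalIntegral.integral_comp_add_right (a := 0) (b := 2 * Real.pi)
    (fun θ : ℝ => g (Complex.exp (θ * Complex.I) * y)) s
  rw [zero_add] at h2
  rw [← h2]
  simp only [Complex.ofReal_add, add_mul, Complex.exp_add, mul_assoc]

/-- Exchanging the factors turns `mob a b` into a rotation of itself. The angle depends on both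
variables, so `rot` cannot be applied directly; after averaging over circles the rotation disappears
pointwise. -/
theorem conv_prod_comm (k : RadialKernel Ω) (k' : RadialKernel Ω') {f : ℂ → ℂ} (hf : BddMeas f)
    (x : ℂ) : (k.prod k').conv f x = (k'.prod k).conv f x := by
  have hg : BddMeas fun y => f (mob x y) := hf.comp (measurable_mob_right x)
  have hpi : (2 * Real.pi : ℂ) ≠ 0 := by exact_mod_cast Real.two_pi_pos.ne'
  refine mul_left_cancel₀ hpi ?_
  refine ((k.prod k').integral_eq_circular_mean hg).trans
    (Eq.trans ?_ ((k'.prod k).integral_eq_circular_mean hg).symm)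
  refine Eq.trans ?_ (integral_prod_swap (μ := k'.μ) (ν := k.μ) _)
  refine integral_congr_ae (.of_forall fun p => ?_)
  obtain ⟨κ, hκ, h⟩ := mob_comm_rot (k'.mem_disk p.2) (k.mem_disk p.1)
  simp only [prod, Prod.swap, h, circular_mean_rot (fun y => f (mob x y)) hκ, mul_comm (k.ρ p.1)]

end RadialKernel

/-! ### Radial convolutions commute with the Laplace–Beltrami operator -/

/-- A smooth function with compact support in the disk. -/
structure TestFn (f : ℂ → ℂ) : Prop where
  smooth : ContDiff ℝ ∞ f
  compact : HasCompactSupport f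
  subset : tsupport f ⊆ disk

theorem TestFn.bddMeas {f : ℂ → ℂ} (hf : TestFn f) : BddMeas f :=
  .of_continuous hf.smooth.continuous hf.compact

theorem TestFn.contDiffAt_two {f : ℂ → ℂ} (hf : TestFn f) (x : ℂ) : ContDiffAt ℝ 2 f x :=
  (contDiff_infty.1 hf.smooth 2).contDiffAt

theorem contDiffOn_mob_right {a : ℂ} (ha : a ∈ disk) : ContDiffOn ℝ ∞ (mob a) disk :=
  contDiffOn_mob.comp (contDiff_prodMk_right a).contDiffOn fun _ hy => ⟨ha, hy⟩

theorem contDiffAt_mob_left {x y : ℂ} (hx : x ∈ disk) (hy : y ∈ disk) :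
    ContDiffAt ℝ ∞ (fun x => mob x y) x :=
  (contDiffOn_mob.contDiffAt ((isOpen_disk.prod isOpen_disk).mem_nhds ⟨hx, hy⟩)).comp x
    (contDiff_prodMk_left y).contDiffAt

/-- The composition of a function with the isometry `mob a`, extended by zero off the disk. -/
def translate (a : ℂ) (f : ℂ → ℂ) : ℂ → ℂ := disk.indicator fun y => f (mob a y)

theorem translate_apply (a : ℂ) (f : ℂ → ℂ) {y : ℂ} (hy : y ∈ disk) :
    translate a f y = f (mob a y) := indicator_of_mem hy _

theorem TestFn.translate {f : ℂ → ℂ} (hf : TestFn f) {a : ℂ} (ha : a ∈ disk) :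
    TestFn (translate a f) := by
  have hC : IsCompact (mob (-a) '' tsupport f) := hf.compact.isCompact.image_of_continuousOn
    ((contDiffOn_mob_right (neg_mem_disk ha)).continuousOn.mono hf.subset)
  have hCU : mob (-a) '' tsupport f ⊆ disk := by
    rintro _ ⟨y, hy, rfl⟩
    exact mob_mem (neg_mem_disk ha) (hf.subset hy)
  obtain ⟨h1, h2, h3⟩ := contDiff_of_eq_zero_off_compact (u := PoincareDisk.translate a f)
    isOpen_disk hC hCU
    ((hf.smooth.comp_contDiffOn (contDiffOn_mob_right ha)).congr fun y hy => translate_apply a f hy)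
    (fun y hy => by
      by_contra h
      have hyd : y ∈ disk := mem_of_indicator_ne_zero h
      rw [translate_apply a f hyd] at h
      exact hy ⟨mob a y, subset_closure h, mob_neg_mob ha hyd⟩)
  exact ⟨h1, h2, h3.trans hCU⟩

/-- A cut-off of the function `(x, y) ↦ g (mob x y)`. -/
def cutoffComp (χ : ℂ → ℝ) (g : ℂ → ℂ) (p : ℂ × ℂ) : ℂ :=
  (disk ×ˢ disk).indicator (fun p => (χ p.1 : ℂ) * g (mob p.1 p.2)) p

/-- Once `x` is confined to the support of `χ`, the relevant `y = mob (-x) w` with `w` in the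
support of `g` fill a compact set. The cut-off thus supplies the compact support in `(x, y)` jointly
that differentiation under the integral needs. -/
theorem cutoffComp_smooth {χ : ℂ → ℝ} (hχ : ContDiff ℝ ∞ χ) (hχc : HasCompactSupport χ)
    (hχs : tsupport χ ⊆ disk) {g : ℂ → ℂ} (hg : TestFn g) :
    ContDiff ℝ ∞ (cutoffComp χ g) ∧ HasCompactSupport (cutoffComp χ g) := by
  have hT : ContinuousOn (fun p : ℂ × ℂ => (p.1, mob (-p.1) p.2)) (disk ×ˢ disk) :=
    continuousOn_fst.prodMk (contDiffOn_mob.continuousOn.comp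
      (continuous_fst.neg.prodMk continuous_snd).continuousOn
      fun p hp => ⟨neg_mem_disk hp.1, hp.2⟩)
  have hC : IsCompact ((fun p : ℂ × ℂ => (p.1, mob (-p.1) p.2)) '' (tsupport χ ×ˢ tsupport g)) :=
    (hχc.isCompact.prod hg.compact.isCompact).image_of_continuousOn
      (hT.mono (prod_mono hχs hg.subset))
  obtain ⟨h1, h2, -⟩ := contDiff_of_eq_zero_off_compact (u := cutoffComp χ g)
    (isOpen_disk.prod isOpen_disk) hC
    (by
      rintro _ ⟨p, hp, rfl⟩
      exact ⟨hχs hp.1, mob_mem (neg_mem_disk (hχs hp.1)) (hg.subset hp.2)⟩)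
    (((Complex.ofRealCLM.contDiff.comp (hχ.comp contDiff_fst)).contDiffOn.mul
      (hg.smooth.comp_contDiffOn contDiffOn_mob)).congr fun p hp => indicator_of_mem hp _)
    (fun p hp => by
      by_contra h
      have hpd : p ∈ disk ×ˢ disk := mem_of_indicator_ne_zero h
      rw [cutoffComp, indicator_of_mem hpd] at h
      refine hp ⟨(p.1, mob p.1 p.2), ⟨subset_closure fun h' => h ?_, subset_closure fun h' => h ?_⟩,
        Prod.ext rfl (mob_neg_mob hpd.1 hpd.2)⟩
      · simp [h']
      · simp only at h'
        simp [h'])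
  exact ⟨h1, h2⟩

theorem exists_cutoff {x : ℂ} (hx : x ∈ disk) : ∃ χ : ℂ → ℝ, ContDiff ℝ ∞ χ ∧
    HasCompactSupport χ ∧ tsupport χ ⊆ disk ∧ ∀ᶠ y in 𝓝 x, χ y = 1 := by
  obtain ⟨ε, hε, h⟩ := Metric.isOpen_iff.1 isOpen_disk x hx
  let χ : ContDiffBump x := ⟨ε / 4, ε / 2, by positivity, by linarith⟩
  refine ⟨χ, χ.contDiff, χ.hasCompactSupport, ?_, χ.eventuallyEq_one⟩
  rw [χ.tsupport_eq]
  exact (closedBall_subset_ball (show ε / 2 < ε by linarith)).trans h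

/-- The second derivative along rotations. -/
def rotHess (g : ℂ → ℂ) (y : ℂ) : ℂ :=
  fderiv ℝ (fderiv ℝ g) y (Complex.I * y) (Complex.I * y) - fderiv ℝ g y y

theorem TestFn.contDiff_fderiv {g : ℂ → ℂ} (hg : TestFn g) : ContDiff ℝ ∞ (fderiv ℝ g) :=
  hg.smooth.fderiv_right (by simp)

theorem TestFn.continuous_hessian {g : ℂ → ℂ} (hg : TestFn g) :
    Continuous (fderiv ℝ (fderiv ℝ g)) :=
  hg.contDiff_fderiv.continuous_fderiv (by norm_num)

theorem TestFn.bddMeas_rotHess {g : ℂ → ℂ} (hg : TestFn g) : BddMeas (rotHess g) := by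
  have h1 := hg.continuous_hessian
  have h2 := hg.contDiff_fderiv.continuous
  refine .of_continuous ?_ ?_
  · unfold rotHess
    fun_prop
  · refine HasCompactSupport.intro hg.compact.isCompact fun y hy => ?_
    have e1 : fderiv ℝ g y = 0 := image_eq_zero_of_notMem_tsupport
      fun h => hy (tsupport_fderiv_subset ℝ h)
    have e2 : fderiv ℝ (fderiv ℝ g) y = 0 := image_eq_zero_of_notMem_tsupport
      fun h => hy (tsupport_fderiv_subset ℝ (tsupport_fderiv_subset ℝ h))
    simp [rotHess, e1, e2]

theorem TestFn.laplacian_continuous_and_hasCompactSupport {g : ℂ → ℂ} (hg : TestFn g) :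
    Continuous (Laplacian.laplacian g) ∧ HasCompactSupport (Laplacian.laplacian g) := by
  have h1 := hg.continuous_hessian
  refine ⟨?_, ?_⟩
  · simp only [funext (laplacian_eq_hessian g)]
    fun_prop
  · refine HasCompactSupport.intro hg.compact.isCompact fun y hy => ?_
    have e2 : fderiv ℝ (fderiv ℝ g) y = 0 := image_eq_zero_of_notMem_tsupport
      fun h => hy (tsupport_fderiv_subset ℝ (tsupport_fderiv_subset ℝ h))
    simp [laplacian_eq_hessian, e2]

theorem laplaceBeltrami_eq (u : ℂ → ℂ) (x : ℂ) : laplaceBeltrami u x =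
    (((1 - ‖x‖ ^ 2) ^ 2 / 4 : ℝ) : ℂ) * Laplacian.laplacian u x := by
  simp [laplaceBeltrami, conformalFactor]

theorem TestFn.continuous_laplaceBeltrami {g : ℂ → ℂ} (hg : TestFn g) :
    Continuous (laplaceBeltrami g) := by
  have := hg.laplacian_continuous_and_hasCompactSupport.1
  simp only [funext (laplaceBeltrami_eq g)]
  fun_prop

theorem TestFn.bddMeas_laplaceBeltrami {g : ℂ → ℂ} (hg : TestFn g) :
    BddMeas (laplaceBeltrami g) := by
  refine .of_continuous hg.continuous_laplaceBeltrami ?_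
  simp only [funext (laplaceBeltrami_eq g)]
  exact hg.laplacian_continuous_and_hasCompactSupport.2.mul_left

theorem hasDerivAt_exp_mul_I (y : ℂ) (θ : ℝ) :
    HasDerivAt (fun θ : ℝ => Complex.exp (θ * Complex.I) * y)
      (Complex.I * (Complex.exp (θ * Complex.I) * y)) θ := by
  have h : HasDerivAt (fun θ : ℝ => (θ : ℂ) * Complex.I) Complex.I θ := by
    simpa using (Complex.ofRealCLM.hasDerivAt (x := θ)).mul_const Complex.I
  exact (h.cexp.mul_const y).congr_deriv (by ring)

/-- The integrand is the second `θ`-derivative of `g (e^{iθ} y)`, hence the derivative of a periodic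
function. -/
theorem circular_mean_rotHess {g : ℂ → ℂ} (hg : TestFn g) (y : ℂ) :
    ∫ θ in (0 : ℝ)..2 * Real.pi, rotHess g (Complex.exp (θ * Complex.I) * y) = 0 := by
  have h1 := hg.continuous_hessian
  have h2 := hg.contDiff_fderiv.continuous
  rw [intervalIntegral.integral_eq_sub_of_hasDerivAt (f := fun θ : ℝ =>
    fderiv ℝ g (Complex.exp (θ * Complex.I) * y) (Complex.I * (Complex.exp (θ * Complex.I) * y)))]
  · simp [Complex.exp_two_pi_mul_I]
  · intro θ _
    have := hasDerivAt_fderiv_comp_curve (hg.contDiffAt_two _) (hasDerivAt_exp_mul_I y θ)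
      ((hasDerivAt_exp_mul_I y θ).const_mul Complex.I)
    refine this.congr_deriv ?_
    rw [← mul_assoc Complex.I Complex.I, Complex.I_mul_I, neg_one_mul, map_neg, rotHess]
    ring
  · refine Continuous.intervalIntegrable ?_ _ _
    unfold rotHess
    fun_prop

theorem hasDerivAt_mob_line (e y : ℂ) {s : ℝ} (h : 1 + s * conj e * y ≠ 0) :
    HasDerivAt (fun s : ℝ => mob (0 + s * e) y) ((e - conj e * y ^ 2) / (1 + s * conj e * y) ^ 2)
      s := by
  have h1 : HasDerivAt (fun s : ℝ => (s : ℂ) * e + y) e s := by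
    simpa using ((Complex.ofRealCLM.hasDerivAt (x := s)).mul_const e).add_const y
  have h2 : HasDerivAt (fun s : ℝ => 1 + (s : ℂ) * conj e * y) (conj e * y) s := by
    simpa using (((Complex.ofRealCLM.hasDerivAt (x := s)).mul_const (conj e)).mul_const y).const_add 1
  have := h1.fun_div h2 h
  refine (this.congr_deriv ?_).congr_of_eventuallyEq (.of_forall fun r => ?_)
  · congr 1
    ring
  · simp [mob]

theorem hasDerivAt_mob_line_deriv (e y : ℂ) :
    HasDerivAt (fun s : ℝ => (e - conj e * y ^ 2) / (1 + s * conj e * y) ^ 2)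
      (-2 * conj e * y * (e - conj e * y ^ 2)) 0 := by
  have h2 : HasDerivAt (fun s : ℝ => 1 + (s : ℂ) * conj e * y) (conj e * y) 0 := by
    simpa using (((Complex.ofRealCLM.hasDerivAt (x := 0)).mul_const (conj e)).mul_const y).const_add 1
  have := (hasDerivAt_const (0 : ℝ) (e - conj e * y ^ 2)).fun_div (h2.fun_pow 2) (by simp)
  refine this.congr_deriv ?_
  simp
  ring

theorem hessian_comp_mob {g : ℂ → ℂ} (hg : TestFn g) {y : ℂ} (hy : y ∈ disk) (e : ℂ) :
    fderiv ℝ (fderiv ℝ fun x => g (mob x y)) 0 e e =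
      fderiv ℝ (fderiv ℝ g) y (e - conj e * y ^ 2) (e - conj e * y ^ 2) +
        fderiv ℝ g y (-2 * conj e * y * (e - conj e * y ^ 2)) := by
  have h : ContDiffAt ℝ 2 (fun x => g (mob x y)) 0 :=
    (hg.contDiffAt_two _).comp 0 (contDiffAt_infty.1 (contDiffAt_mob_left zero_mem_disk hy) 2)
  have hc : Continuous fun s : ℝ => 1 + (s : ℂ) * conj e * y := by fun_prop
  have hn : ∀ᶠ s : ℝ in 𝓝 0, 1 + (s : ℂ) * conj e * y ≠ 0 :=
    hc.continuousAt.eventually_ne (by simp)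
  rw [hessian_eq_deriv_deriv h, deriv_deriv_comp_curve (g := g) (hg.contDiffAt_two _)
    (hn.mono fun s hs => hasDerivAt_mob_line e y hs) (hasDerivAt_mob_line_deriv e y)]
  simp [mob_zero_left]

/-- The Laplacian of `x ↦ g (mob x y)` at the origin. -/
theorem laplacian_comp_mob {g : ℂ → ℂ} (hg : TestFn g) {y : ℂ} (hy : y ∈ disk) :
    Laplacian.laplacian (fun x => g (mob x y)) 0 =
      4 * laplaceBeltrami g y + 4 * rotHess g y := by
  -- The vectors `e - conj e * y ^ 2` for `e = 1` and `e = I` are the velocities at `y` of the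
  -- translations along the two axes. The sum of the squares of these Killing fields is `4 Δ` plus
  -- four times the square of the rotation field, a Casimir identity.
  have hI : Complex.I - conj Complex.I * y ^ 2 = Complex.I * (1 + y ^ 2) := by simp; ring
  have hI2 : -2 * conj Complex.I * y * (Complex.I * (1 + y ^ 2)) = -(2 : ℝ) • (y + y ^ 3) := by
    simp
    linear_combination (2 * y * (1 + y ^ 2)) * Complex.I_mul_I
  have h1 : -2 * conj 1 * y * (1 - conj 1 * y ^ 2) = -(2 : ℝ) • (y - y ^ 3) := by
    simp
    ring
  rw [laplacian_eq_hessian, hessian_comp_mob hg hy, hessian_comp_mob hg hy, hI, hI2, h1, map_smul,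
    map_smul, map_sub (fderiv ℝ g y), map_add (fderiv ℝ g y), rotHess, laplaceBeltrami_eq, laplacian_eq_hessian]
  rw [hessian_expand (hg.contDiffAt_two y) (1 - conj 1 * y ^ 2),
    hessian_expand (hg.contDiffAt_two y) (Complex.I * (1 + y ^ 2)),
    hessian_expand (hg.contDiffAt_two y) (Complex.I * y), ← Complex.normSq_eq_norm_sq,
    Complex.normSq_apply]
  simp [pow_two]
  ring

theorem hasDerivAt_mob {a y : ℂ} (ha : a ∈ disk) (hy : y ∈ disk) :
    HasDerivAt (mob a) (((1 - ‖a‖ ^ 2 : ℝ) : ℂ) / (1 + conj a * y) ^ 2) y := by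
  have h1 : HasDerivAt (fun y => a + y) 1 y := (hasDerivAt_id y).const_add a
  have h2 : HasDerivAt (fun y => 1 + conj a * y) (conj a) y := by
    simpa using ((hasDerivAt_id y).const_mul (conj a)).const_add 1
  refine (h1.fun_div h2 (one_add_conj_mul_ne_zero ha hy)).congr_deriv ?_
  congr 1
  rw [← Complex.normSq_eq_norm_sq]
  push_cast
  rw [← Complex.mul_conj]
  ring

/-- The Laplace-Beltrami operator is invariant under the isometries `mob a`. -/
theorem laplaceBeltrami_comp_mob {u : ℂ → ℂ} {a y : ℂ} (ha : a ∈ disk) (hy : y ∈ disk)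
    (hu : ContDiffAt ℝ 2 u (mob a y)) :
    laplaceBeltrami (fun y => u (mob a y)) y = laplaceBeltrami u (mob a y) := by
  have hne := one_add_conj_mul_ne_zero ha hy
  have hev : ∀ᶠ w in 𝓝 y, HasDerivAt (mob a) (((1 - ‖a‖ ^ 2 : ℝ) : ℂ) / (1 + conj a * w) ^ 2) w := by
    filter_upwards [isOpen_disk.mem_nhds hy] with w hw using hasDerivAt_mob ha hw
  have h2 : HasDerivAt (fun y => 1 + conj a * y) (conj a) y := by
    simpa using ((hasDerivAt_id y).const_mul (conj a)).const_add 1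
  have hd := (hasDerivAt_const y ((1 - ‖a‖ ^ 2 : ℝ) : ℂ)).fun_div (h2.fun_pow 2) (pow_ne_zero 2 hne)
  rw [laplaceBeltrami_eq, laplaceBeltrami_eq, one_sub_norm_mob_sq ha hy,
    laplacian_comp_holomorphic hev hd
      (contDiffAt_infty.1 ((contDiffOn_mob_right ha).contDiffAt (isOpen_disk.mem_nhds hy)) 2) hu,
    norm_div, norm_pow, Complex.norm_real, Real.norm_of_nonneg (one_sub_pos ha).le]
  push_cast
  ring

theorem laplaceBeltrami_congr {u v : ℂ → ℂ} {x : ℂ} (h : u =ᶠ[𝓝 x] v) :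
    laplaceBeltrami u x = laplaceBeltrami v x := by
  simp only [laplaceBeltrami, (InnerProductSpace.laplacian_congr_nhds h).self_of_nhds]

theorem laplaceBeltrami_translate {f : ℂ → ℂ} (hf : TestFn f) {a y : ℂ} (ha : a ∈ disk)
    (hy : y ∈ disk) : laplaceBeltrami (translate a f) y = laplaceBeltrami f (mob a y) := by
  rw [← laplaceBeltrami_comp_mob ha hy (hf.contDiffAt_two _)]
  refine laplaceBeltrami_congr ?_
  filter_upwards [isOpen_disk.mem_nhds hy] with w hw using translate_apply a f hw

namespace RadialKernel

variable {Ω : Type} [MeasurableSpace Ω]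

theorem conv_eventuallyEq (k : RadialKernel Ω) (g : ℂ → ℂ) {x : ℂ} (hx : x ∈ disk) {χ : ℂ → ℝ}
    (hχ : ∀ᶠ y in 𝓝 x, χ y = 1) :
    k.conv g =ᶠ[𝓝 x] fun x => ∫ a, k.ρ a * cutoffComp χ g (x, k.Y a) ∂k.μ := by
  filter_upwards [hχ, isOpen_disk.mem_nhds hx] with y hy hyd
  have : ∀ a, cutoffComp χ g (y, k.Y a) = g (mob y (k.Y a)) := fun a => by
    rw [cutoffComp, indicator_of_mem (mk_mem_prod hyd (k.mem_disk a))]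
    simp [hy]
  simp only [conv, this]

theorem contDiffOn_conv (k : RadialKernel Ω) {f : ℂ → ℂ} (hf : TestFn f) :
    ContDiffOn ℝ ∞ (k.conv f) disk := by
  intro x hx
  obtain ⟨χ, h1, h2, h3, h4⟩ := exists_cutoff hx
  obtain ⟨h5, h6⟩ := cutoffComp_smooth h1 h2 h3 hf
  exact ((contDiff_integral_comp k.integrable_ρ k.measurable_Y h5 h6).contDiffAt.congr_of_eventuallyEq
    (k.conv_eventuallyEq f hx h4)).contDiffWithinAt

/-- Under the integral the Laplacian in `x` becomes the Laplacian in `y` plus a second derivative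
along rotations, and the latter has zero circular means. -/
theorem laplaceBeltrami_conv_zero (k : RadialKernel Ω) {g : ℂ → ℂ} (hg : TestFn g) :
    laplaceBeltrami (k.conv g) 0 = ∫ a, k.ρ a * laplaceBeltrami g (k.Y a) ∂k.μ := by
  obtain ⟨χ, h1, h2, h3, h4⟩ := exists_cutoff zero_mem_disk
  obtain ⟨h5, h6⟩ := cutoffComp_smooth h1 h2 h3 hg
  have hl : ∀ a, Laplacian.laplacian (fun x => cutoffComp χ g (x, k.Y a)) 0 =
      4 * laplaceBeltrami g (k.Y a) + 4 * rotHess g (k.Y a) := fun a => by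
    rw [← laplacian_comp_mob hg (k.mem_disk a)]
    refine (InnerProductSpace.laplacian_congr_nhds ?_).self_of_nhds
    filter_upwards [h4, isOpen_disk.mem_nhds zero_mem_disk] with y hy hyd
    rw [cutoffComp, indicator_of_mem (mk_mem_prod hyd (k.mem_disk a))]
    simp [hy]
  have h0 : ∫ a, k.ρ a * rotHess g (k.Y a) ∂k.μ = 0 := by
    have hpi : (2 * Real.pi : ℂ) ≠ 0 := by exact_mod_cast Real.two_pi_pos.ne'
    refine mul_left_cancel₀ hpi ?_
    rw [k.integral_eq_circular_mean hg.bddMeas_rotHess]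
    simp [circular_mean_rotHess hg]
  rw [laplaceBeltrami_congr (k.conv_eventuallyEq g zero_mem_disk h4), laplaceBeltrami_eq,
    laplacian_integral_comp k.integrable_ρ k.measurable_Y h5 h6]
  simp only [hl, mul_add, mul_left_comm _ (4 : ℂ)]
  rw [integral_add ((k.integrable hg.bddMeas_laplaceBeltrami).const_mul 4)
    ((k.integrable hg.bddMeas_rotHess).const_mul 4), integral_const_mul, integral_const_mul, h0]
  simp

/-- Radial convolution commutes with isometries, again because the rotation from `mob_mob` is
absorbed by the invariance of the measure. This reduces statements at `x` to statements at the
origin. -/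
theorem conv_mob (k : RadialKernel Ω) {f : ℂ → ℂ} (hf : TestFn f) {a x : ℂ} (ha : a ∈ disk)
    (hx : x ∈ disk) : k.conv f (mob a x) = k.conv (translate a f) x := by
  obtain ⟨κ, hκ, h⟩ := mob_mob ha hx
  rw [← k.conv_eq_of_rot (hf.translate ha).bddMeas x hκ]
  simp only [conv, h _ (k.mem_disk _),
    translate_apply a f (mob_mem hx (mul_mem_disk hκ (k.mem_disk _)))]

/-- The Laplace-Beltrami operator commutes with radial convolutions. -/
theorem laplaceBeltrami_conv (k : RadialKernel Ω) {f : ℂ → ℂ} (hf : TestFn f) {x : ℂ}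
    (hx : x ∈ disk) : laplaceBeltrami (k.conv f) x = k.conv (laplaceBeltrami f) x := by
  have h1 := laplaceBeltrami_comp_mob (u := k.conv f) hx zero_mem_disk (by
    rw [mob_zero_right]
    exact contDiffAt_infty.1 ((k.contDiffOn_conv hf).contDiffAt (isOpen_disk.mem_nhds hx)) 2)
  rw [mob_zero_right] at h1
  rw [← h1, laplaceBeltrami_congr (v := k.conv (translate x f)),
    k.laplaceBeltrami_conv_zero (hf.translate hx)]
  · simp only [laplaceBeltrami_translate hf hx (k.mem_disk _), conv]
  · filter_upwards [isOpen_disk.mem_nhds zero_mem_disk] with y hy using k.conv_mob hf hx hy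

end RadialKernel

/-! ### Geodesic polar coordinates about the origin -/

/-- The point at distance `t` from the origin in the direction `e^{iθ}`. -/
def polar (t θ : ℝ) : ℂ := Complex.exp (θ * Complex.I) * (Real.tanh (t / 2) : ℝ)

/-- The derivative of `polar` in `t`. -/
def polar₁ (t θ : ℝ) : ℂ := Complex.exp (θ * Complex.I) * ((1 - Real.tanh (t / 2) ^ 2) / 2 : ℝ)

/-- The second derivative of `polar` in `t`. -/
def polar₂ (t θ : ℝ) : ℂ :=
  Complex.exp (θ * Complex.I) * (-Real.tanh (t / 2) * ((1 - Real.tanh (t / 2) ^ 2) / 2) : ℝ)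

theorem hasDerivAt_tanh_half (t : ℝ) :
    HasDerivAt (fun t => Real.tanh (t / 2)) ((1 - Real.tanh (t / 2) ^ 2) / 2) t := by
  have h1 : HasDerivAt (fun t : ℝ => t / 2) (1 / 2) t := (hasDerivAt_id t).div_const 2
  have hc : Real.cosh (t / 2) ≠ 0 := (Real.cosh_pos _).ne'
  have h2 := h1.sinh.fun_div h1.cosh hc
  have e : (fun t => Real.tanh (t / 2)) = fun t => Real.sinh (t / 2) / Real.cosh (t / 2) := by
    funext t; exact Real.tanh_eq_sinh_div_cosh _
  rw [e]
  refine h2.congr_deriv ?_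
  rw [Real.tanh_eq_sinh_div_cosh]
  field_simp

theorem continuous_tanh_half : Continuous fun t : ℝ => Real.tanh (t / 2) :=
  continuous_iff_continuousAt.2 fun t => (hasDerivAt_tanh_half t).continuousAt

theorem tanh_half_ne_zero {t : ℝ} (ht : 0 < t) : ((Real.tanh (t / 2) : ℝ) : ℂ) ≠ 0 := by
  have : 0 < Real.tanh (t / 2) := by
    rw [Real.tanh_eq_sinh_div_cosh]
    exact div_pos (Real.sinh_pos_iff.2 (by positivity)) (Real.cosh_pos _)
  exact_mod_cast this.ne'

theorem hasDerivAt_polar (t θ : ℝ) : HasDerivAt (fun t => polar t θ) (polar₁ t θ) t :=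
  ((hasDerivAt_tanh_half t).ofReal_comp).const_mul _

theorem hasDerivAt_polar₁ (t θ : ℝ) : HasDerivAt (fun t => polar₁ t θ) (polar₂ t θ) t := by
  have h := ((((hasDerivAt_tanh_half t).fun_pow 2).const_sub 1).div_const 2).ofReal_comp.const_mul
    (Complex.exp (θ * Complex.I))
  refine h.congr_deriv ?_
  rw [polar₂]
  congr 2
  simp
  ring

theorem continuous_polar : Continuous fun p : ℝ × ℝ => polar p.1 p.2 := by
  have := continuous_tanh_half.comp (continuous_fst (X := ℝ) (Y := ℝ))
  unfold polar
  fun_prop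

theorem continuous_polar₁ : Continuous fun p : ℝ × ℝ => polar₁ p.1 p.2 := by
  have := continuous_tanh_half.comp (continuous_fst (X := ℝ) (Y := ℝ))
  unfold polar₁
  fun_prop

theorem continuous_polar₂ : Continuous fun p : ℝ × ℝ => polar₂ p.1 p.2 := by
  have := continuous_tanh_half.comp (continuous_fst (X := ℝ) (Y := ℝ))
  unfold polar₂
  fun_prop

theorem polar_mem (t θ : ℝ) : polar t θ ∈ disk := by
  refine mul_mem_disk (Complex.norm_exp_ofReal_mul_I θ) ?_
  rw [mem_disk_iff, Complex.norm_real]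
  exact Real.abs_tanh_lt_one _

theorem norm_polar₁_le (t θ : ℝ) : ‖polar₁ t θ‖ ≤ 1 := by
  rw [polar₁, norm_mul, Complex.norm_exp_ofReal_mul_I, one_mul, Complex.norm_real,
    Real.norm_of_nonneg (by linarith [Real.tanh_sq_lt_one (t / 2)])]
  linarith [sq_nonneg (Real.tanh (t / 2))]

theorem norm_polar₂_le (t θ : ℝ) : ‖polar₂ t θ‖ ≤ 1 := by
  rw [polar₂, norm_mul, Complex.norm_exp_ofReal_mul_I, one_mul, Complex.norm_real, norm_mul,
    norm_neg, Real.norm_eq_abs,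
    Real.norm_of_nonneg (by linarith [Real.tanh_sq_lt_one (t / 2)])]
  nlinarith [Real.abs_tanh_lt_one (t / 2), abs_nonneg (Real.tanh (t / 2)),
    sq_nonneg (Real.tanh (t / 2)), Real.tanh_sq_lt_one (t / 2)]

/-- The measure `dt dθ` on `(0, ∞) × (0, 2π]`. -/
def polarMeasure : Measure (ℝ × ℝ) :=
  (volume.restrict (Ioi (0 : ℝ))).prod (volume.restrict (Ioc (0 : ℝ) (2 * Real.pi)))

instance : SFinite polarMeasure := by unfold polarMeasure; infer_instance

theorem integrable_exp_neg_mul {z : ℂ} (hz : 0 < z.re) :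
    Integrable (fun t : ℝ => Complex.exp (-z * t)) (volume.restrict (Ioi (0 : ℝ))) :=
  integrableOn_exp_mul_complex_Ioi (by simpa using hz) 0

theorem integrable_exp_polar {z : ℂ} (hz : 0 < z.re) :
    Integrable (fun p : ℝ × ℝ => Complex.exp (-z * p.1)) polarMeasure :=
  (integrable_exp_neg_mul hz).comp_fst _

theorem integral_polarMeasure {g : ℝ × ℝ → ℂ} (hg : Integrable g polarMeasure) :
    ∫ p, g p ∂polarMeasure =
      ∫ t in Ioi (0 : ℝ), ∫ θ in (0 : ℝ)..2 * Real.pi, g (t, θ) := by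
  simp only [intervalIntegral.integral_of_le Real.two_pi_pos.le]
  exact integral_prod _ hg

theorem integrable_polar {z : ℂ} (hz : 0 < z.re) {h : ℝ × ℝ → ℂ} (hh : Measurable h) {C : ℝ}
    (hC : ∀ p, ‖h p‖ ≤ C) :
    Integrable (fun p : ℝ × ℝ => Complex.exp (-z * p.1) * h p) polarMeasure :=
  integrable_weight_mul_of_bounded (integrable_exp_polar hz) hh.aestronglyMeasurable hC

theorem integrable_polar_comp {z : ℂ} (hz : 0 < z.re) {g : ℂ → ℂ} (hg : BddMeas g) :
    Integrable (fun p : ℝ × ℝ => Complex.exp (-z * p.1) * g (polar p.1 p.2)) polarMeasure := by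
  obtain ⟨C, hC⟩ := hg.bounded
  exact integrable_polar hz (hg.measurable.comp continuous_polar.measurable) fun p => hC _

/-- The radial measure `e^{-zt} dt dθ`. -/
def polarKernel (z : ℂ) (hz : 0 < z.re) : RadialKernel (ℝ × ℝ) where
  μ := polarMeasure
  sfinite := inferInstance
  ρ := fun p => Complex.exp (-z * p.1)
  Y := fun p => polar p.1 p.2
  measurable_ρ := by fun_prop
  integrable_ρ := integrable_exp_polar hz
  measurable_Y := continuous_polar.measurable
  mem_disk := fun p => polar_mem _ _
  rot := by
    intro g hg κ hκ
    rw [integral_polarMeasure (integrable_polar_comp hz hg),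
      integral_polarMeasure (integrable_polar_comp hz (hg.comp (measurable_const_mul κ)))]
    simp only [intervalIntegral.integral_const_mul]
    congr 1
    ext t
    congr 1
    have := RadialKernel.circular_mean_rot g hκ (Real.tanh (t / 2) : ℝ)
    simp only [polar, ← this]
    congr 1
    ext θ
    ring_nf

/-- The Laplace-Beltrami operator in polar coordinates. -/
theorem laplaceBeltrami_polar {f : ℂ → ℂ} (hf : TestFn f) {t : ℝ} (ht : 0 < t) (θ : ℝ) :
    let τ : ℂ := (Real.tanh (t / 2) : ℝ)
    laplaceBeltrami f (polar t θ) =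
      (fderiv ℝ (fderiv ℝ f) (polar t θ) (polar₁ t θ) (polar₁ t θ) +
        fderiv ℝ f (polar t θ) (polar₂ t θ)) +
      (1 + τ ^ 2) / (2 * τ) * fderiv ℝ f (polar t θ) (polar₁ t θ) +
      ((1 - τ ^ 2) / (2 * τ)) ^ 2 * rotHess f (polar t θ) := by
  -- With `τ = tanh (t / 2)` the coefficients are `(1 + τ²) / (2τ) = coth t` and `(1 - τ²) / (2τ) =
  -- 1 / sinh t`.
  intro τ
  have hτ : τ ≠ 0 := tanh_half_ne_zero ht
  have hu := hf.contDiffAt_two (polar t θ)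
  have hnorm : ‖polar t θ‖ ^ 2 = Real.tanh (t / 2) ^ 2 := by
    rw [polar, norm_mul, Complex.norm_exp_ofReal_mul_I, one_mul, Complex.norm_real,
      Real.norm_eq_abs, sq_abs]
  have hl := hessian_add_hessian_I_mul hu (Complex.exp (θ * Complex.I))
  rw [Complex.norm_exp_ofReal_mul_I, one_pow, Complex.ofReal_one, one_mul] at hl
  rw [laplaceBeltrami_eq, hnorm, ← hl, rotHess]
  set D := fderiv ℝ f (polar t θ) with hD
  set B := fderiv ℝ (fderiv ℝ f) (polar t θ) with hB
  have e0 : polar t θ = Real.tanh (t / 2) • Complex.exp (θ * Complex.I) := by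
    rw [polar, Complex.real_smul, mul_comm]
  have e1 : polar₁ t θ = ((1 - Real.tanh (t / 2) ^ 2) / 2) • Complex.exp (θ * Complex.I) := by
    rw [polar₁, Complex.real_smul, mul_comm]
  have e2 : polar₂ t θ = (-Real.tanh (t / 2) * ((1 - Real.tanh (t / 2) ^ 2) / 2)) •
      Complex.exp (θ * Complex.I) := by
    rw [polar₂, Complex.real_smul, mul_comm]
  have e3 : Complex.I * polar t θ = Real.tanh (t / 2) • (Complex.I * Complex.exp (θ * Complex.I)) := by
    rw [e0, mul_smul_comm]
  have e4 : D (polar t θ) = Real.tanh (t / 2) • D (Complex.exp (θ * Complex.I)) := by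
    conv_lhs => rw [e0, map_smul]
  rw [e1, e2, e3, e4]
  simp only [map_smulₛₗ, smul_apply, RingHom.id_apply]
  simp only [Complex.real_smul]
  push_cast
  change _ = _ + (1 + τ ^ 2) / (2 * τ) * _ + ((1 - τ ^ 2) / (2 * τ)) ^ 2 * _
  rw [show (Complex.tanh (t / 2)) = τ by simp [τ]]
  field_simp
  ring

/-! ### The recurrence from `z` to `z + 2` -/

section Recurrence

variable {f : ℂ → ℂ}

/-- The first derivative in `t` of `f` in polar coordinates. -/
def radial₁ (f : ℂ → ℂ) (p : ℝ × ℝ) : ℂ := fderiv ℝ f (polar p.1 p.2) (polar₁ p.1 p.2)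

/-- The second derivative in `t` of `f` in polar coordinates. -/
def radial₂ (f : ℂ → ℂ) (p : ℝ × ℝ) : ℂ :=
  fderiv ℝ (fderiv ℝ f) (polar p.1 p.2) (polar₁ p.1 p.2) (polar₁ p.1 p.2) +
    fderiv ℝ f (polar p.1 p.2) (polar₂ p.1 p.2)

theorem continuous_radial₁ (hf : TestFn f) : Continuous (radial₁ f) :=
  (hf.contDiff_fderiv.continuous.comp continuous_polar).clm_apply continuous_polar₁

theorem continuous_radial₂ (hf : TestFn f) : Continuous (radial₂ f) :=
  (((hf.continuous_hessian.comp continuous_polar).clm_apply continuous_polar₁).clm_apply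
    continuous_polar₁).add
    ((hf.contDiff_fderiv.continuous.comp continuous_polar).clm_apply continuous_polar₂)

theorem exists_bound_radial₁ (hf : TestFn f) : ∃ C, ∀ p, ‖radial₁ f p‖ ≤ C := by
  obtain ⟨C, hC⟩ := (hf.compact.fderiv ℝ).exists_bound_of_continuous hf.contDiff_fderiv.continuous
  exact ⟨C, fun p => (ContinuousLinearMap.le_of_opNorm_le_of_le _ (hC _)
    (norm_polar₁_le _ _)).trans_eq (mul_one C)⟩

theorem exists_bound_hessian (hf : TestFn f) (v w : ℂ) :
    ∃ C, ∀ y, ‖fderiv ℝ (fderiv ℝ f) y v w‖ ≤ C := by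
  have hc : Continuous fun y => fderiv ℝ (fderiv ℝ f) y v w := by
    have := hf.continuous_hessian
    fun_prop
  refine hc.bounded_above_of_compact_support
    (HasCompactSupport.intro hf.compact.isCompact fun y hy => ?_)
  have : fderiv ℝ (fderiv ℝ f) y = 0 := image_eq_zero_of_notMem_tsupport
    fun h => hy (tsupport_fderiv_subset ℝ (tsupport_fderiv_subset ℝ h))
  simp [this]

theorem exists_bound_radial₂ (hf : TestFn f) : ∃ C, ∀ p, ‖radial₂ f p‖ ≤ C := by
  obtain ⟨C, hC⟩ := (hf.compact.fderiv ℝ).exists_bound_of_continuous hf.contDiff_fderiv.continuous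
  obtain ⟨D₁, h1⟩ := exists_bound_hessian hf 1 1
  obtain ⟨D₂, h2⟩ := exists_bound_hessian hf 1 Complex.I
  obtain ⟨D₃, h3⟩ := exists_bound_hessian hf Complex.I Complex.I
  have hmul : ∀ (r : ℝ) (c : ℂ) (D : ℝ), |r| ≤ 1 → ‖c‖ ≤ D → ‖(r : ℂ) * c‖ ≤ D :=
    fun r c D hr hc => by
      rw [norm_mul, Complex.norm_real, Real.norm_eq_abs]
      nlinarith [norm_nonneg c, abs_nonneg r]
  refine ⟨D₁ + 2 * D₂ + D₃ + C * 1, fun p => (norm_add_le _ _).trans (add_le_add ?_ ?_)⟩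
  · have hv := norm_polar₁_le p.1 p.2
    have hr : |(polar₁ p.1 p.2).re| ≤ 1 := (Complex.abs_re_le_norm _).trans hv
    have hi : |(polar₁ p.1 p.2).im| ≤ 1 := (Complex.abs_im_le_norm _).trans hv
    rw [hessian_expand (hf.contDiffAt_two _)]
    refine (norm_add_le _ _).trans (add_le_add ((norm_add_le _ _).trans (add_le_add ?_ ?_)) ?_)
    · rw [pow_two, mul_assoc]
      exact hmul _ _ _ hr (hmul _ _ _ hr (h1 _))
    · rw [mul_assoc, mul_assoc, norm_mul, Complex.norm_two]
      exact mul_le_mul_of_nonneg_left (hmul _ _ _ hr (hmul _ _ _ hi (h2 _))) zero_le_two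
    · rw [pow_two, mul_assoc]
      exact hmul _ _ _ hi (hmul _ _ _ hi (h3 _))
  · exact (ContinuousLinearMap.le_opNorm _ _).trans (mul_le_mul (hC _) (norm_polar₂_le _ _)
      (norm_nonneg _) ((norm_nonneg _).trans (hC 0)))

theorem hasDerivAt_radial (hf : TestFn f) (t θ : ℝ) :
    HasDerivAt (fun t => f (polar t θ)) (radial₁ f (t, θ)) t :=
  hasDerivAt_comp_curve (hf.contDiffAt_two _) (hasDerivAt_polar t θ)

theorem hasDerivAt_radial₁ (hf : TestFn f) (t θ : ℝ) :
    HasDerivAt (fun t => radial₁ f (t, θ)) (radial₂ f (t, θ)) t :=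
  hasDerivAt_fderiv_comp_curve (hf.contDiffAt_two _) (hasDerivAt_polar t θ)
    (hasDerivAt_polar₁ t θ)

theorem hasDerivAt_exp_neg_mul (z : ℂ) (t : ℝ) :
    HasDerivAt (fun t : ℝ => Complex.exp (-z * t)) (-z * Complex.exp (-z * t)) t := by
  have h : HasDerivAt (fun t : ℝ => -z * (t : ℂ)) (-z) t := by
    simpa using (Complex.ofRealCLM.hasDerivAt (x := t)).const_mul (-z)
  exact h.cexp.congr_deriv (mul_comm _ _)

/-- The total `t`-derivative in the recurrence for the operators `e^{-zt} dt dθ`. -/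
def radialTotal (z : ℂ) (f : ℂ → ℂ) (p : ℝ × ℝ) : ℂ :=
  (-z * Complex.exp (-z * p.1) + (z + 2) * Complex.exp (-(z + 2) * p.1)) *
      (radial₁ f p + (z + 1) * f (polar p.1 p.2)) +
    (Complex.exp (-z * p.1) - Complex.exp (-(z + 2) * p.1)) *
      (radial₂ f p + (z + 1) * radial₁ f p)

theorem continuous_radialTotal (hf : TestFn f) (z : ℂ) : Continuous (radialTotal z f) := by
  have h1 := continuous_radial₁ hf
  have h2 := continuous_radial₂ hf
  have h3 := hf.smooth.continuous.comp continuous_polar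
  have he : ∀ w : ℂ, Continuous fun p : ℝ × ℝ => Complex.exp (-w * p.1) := fun w => by fun_prop
  exact (((he z).const_mul (-z)).add ((he (z + 2)).const_mul (z + 2))).mul
    (h1.add (h3.const_mul (z + 1))) |>.add
    (((he z).sub (he (z + 2))).mul (h2.add (h1.const_mul (z + 1))))

theorem re_add_two_pos {z : ℂ} (hz : 0 < z.re) : 0 < (z + 2).re := by
  simp; linarith

theorem integrable_radialTotal (hf : TestFn f) {z : ℂ} (hz : 0 < z.re) :
    Integrable (radialTotal z f) polarMeasure := by
  obtain ⟨C₁, h1⟩ := exists_bound_radial₁ hf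
  obtain ⟨C₂, h2⟩ := exists_bound_radial₂ hf
  have a0 := integrable_polar_comp hz hf.bddMeas
  have b0 := integrable_polar_comp (re_add_two_pos hz) hf.bddMeas
  have a1 := integrable_polar hz (continuous_radial₁ hf).measurable h1
  have b1 := integrable_polar (re_add_two_pos hz) (continuous_radial₁ hf).measurable h1
  have a2 := integrable_polar hz (continuous_radial₂ hf).measurable h2
  have b2 := integrable_polar (re_add_two_pos hz) (continuous_radial₂ hf).measurable h2
  refine (((((a0.const_mul (-z * (z + 1))).add (b0.const_mul ((z + 2) * (z + 1)))).add
    (a1.const_mul 1)).add (b1.const_mul 1)).add (a2.sub b2)).congr (.of_forall fun p => ?_)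
  simp only [Pi.add_apply, Pi.sub_apply, radialTotal]
  ring

theorem tendsto_exp_neg_mul {z : ℂ} (hz : 0 < z.re) :
    Tendsto (fun t : ℝ => Complex.exp (-z * t)) atTop (𝓝 0) := by
  rw [tendsto_zero_iff_norm_tendsto_zero]
  have : ∀ t : ℝ, ‖Complex.exp (-z * t)‖ = Real.exp (-(z.re * t)) := fun t => by
    simp [Complex.norm_exp]
  simp only [this]
  exact Real.tendsto_exp_neg_atTop_nhds_zero.comp (tendsto_id.const_mul_atTop hz)

/-- The primitive vanishes at `0`, where the two exponentials agree, and at infinity, where both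
decay against a bounded factor. -/
theorem integral_radialTotal (hf : TestFn f) {z : ℂ} (hz : 0 < z.re) {θ : ℝ}
    (hi : Integrable (fun t => radialTotal z f (t, θ)) (volume.restrict (Ioi (0 : ℝ)))) :
    ∫ t in Ioi (0 : ℝ), radialTotal z f (t, θ) = 0 := by
  obtain ⟨C₁, h1⟩ := exists_bound_radial₁ hf
  obtain ⟨C, h0⟩ := hf.bddMeas.bounded
  have hd : ∀ t ∈ Ici (0 : ℝ), HasDerivAt
      (fun t : ℝ => (Complex.exp (-z * t) - Complex.exp (-(z + 2) * t)) *
        (radial₁ f (t, θ) + (z + 1) * f (polar t θ))) (radialTotal z f (t, θ)) t := fun t _ => by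
    refine (((hasDerivAt_exp_neg_mul z t).fun_sub (hasDerivAt_exp_neg_mul (z + 2) t)).fun_mul
      ((hasDerivAt_radial₁ hf t θ).fun_add
        ((hasDerivAt_radial hf t θ).const_mul (z + 1)))).congr_deriv ?_
    simp only [radialTotal]
    ring
  rw [integral_Ioi_of_hasDerivAt_of_tendsto' hd hi (m := 0)]
  · simp
  · have h2 := (tendsto_exp_neg_mul hz).sub (tendsto_exp_neg_mul (re_add_two_pos hz))
    rw [sub_zero] at h2
    refine h2.zero_mul_isBoundedUnder_le (isBoundedUnder_of ⟨C₁ + ‖z + 1‖ * C, fun t => ?_⟩)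
    refine (norm_add_le _ _).trans (add_le_add (h1 _) ?_)
    rw [norm_mul]
    exact mul_le_mul_of_nonneg_left (h0 _) (norm_nonneg _)

theorem tanh_half_eq (t : ℝ) :
    ((Real.tanh (t / 2) : ℝ) : ℂ) * (1 + Complex.exp (-t)) = 1 - Complex.exp (-t) := by
  have h : Real.tanh (t / 2) * (1 + Real.exp (-t)) = 1 - Real.exp (-t) := by
    have e : Real.exp (-t) = Real.exp (-(t / 2)) * Real.exp (-(t / 2)) := by
      rw [← Real.exp_add]; ring_nf
    have e' : Real.exp (t / 2) * Real.exp (-(t / 2)) = 1 := by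
      rw [← Real.exp_add]; simp
    have hp := Real.exp_pos (t / 2)
    have hp' := Real.exp_pos (-(t / 2))
    rw [Real.tanh_eq, e, div_mul_eq_mul_div, div_eq_iff (by positivity)]
    linear_combination 2 * Real.exp (-(t / 2)) ^ 1 * e'
  exact_mod_cast h

/-- The weight `e^{-zt} - e^{-(z+2)t}` is chosen so that its product with `coth t` is `e^{-zt} +
e^{-(z+2)t}`. That is the coefficient of `∂_t f` in the expanded total derivative, and the
zeroth-order terms match because of the constants `z(z+1)` and `(z+1)(z+2)`. -/
theorem recurrence_integrand (hf : TestFn f) (z : ℂ) {t : ℝ} (ht : 0 < t) (θ : ℝ) :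
    Complex.exp (-z * t) * (laplaceBeltrami f (polar t θ) - z * (z + 1) * f (polar t θ)) -
      Complex.exp (-(z + 2) * t) *
        (laplaceBeltrami f (polar t θ) - (z + 1) * (z + 2) * f (polar t θ)) =
    radialTotal z f (t, θ) + (Complex.exp (-z * t) - Complex.exp (-(z + 2) * t)) *
      ((1 - ((Real.tanh (t / 2) : ℝ) : ℂ) ^ 2) / (2 * ((Real.tanh (t / 2) : ℝ) : ℂ))) ^ 2 *
        rotHess f (polar t θ) := by
  have h1 := laplaceBeltrami_polar hf ht θ
  have hτ := tanh_half_ne_zero ht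
  have h2 := tanh_half_eq t
  have h3 : Complex.exp (-(z + 2) * t) = Complex.exp (-z * t) * Complex.exp (-t) ^ 2 := by
    rw [← Complex.exp_nat_mul, ← Complex.exp_add]
    congr 1
    push_cast
    ring
  -- This is `coth t = (1 + e^{-2t}) / (1 - e^{-2t})`.
  have h4 : (Complex.exp (-z * t) - Complex.exp (-(z + 2) * t)) *
      ((1 + ((Real.tanh (t / 2) : ℝ) : ℂ) ^ 2) / (2 * ((Real.tanh (t / 2) : ℝ) : ℂ))) =
      Complex.exp (-z * t) + Complex.exp (-(z + 2) * t) := by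
    rw [h3, ← mul_div_assoc, div_eq_iff (by simpa using hτ)]
    have hE : (1 + Complex.exp (-t)) ≠ 0 := by
      have : (1 + Real.exp (-t)) ≠ 0 := by positivity
      exact_mod_cast this
    generalize ((Real.tanh (t / 2) : ℝ) : ℂ) = τ at *
    generalize Complex.exp (-(t : ℂ)) = E at *
    refine mul_right_cancel₀ (pow_ne_zero 2 hE) ?_
    linear_combination Complex.exp (-z * t) * ((1 - E ^ 2) * (τ * (1 + E) + (1 - E)) -
      2 * (1 + E ^ 2) * (1 + E)) * h2
  simp only at h1
  rw [h1]
  simp only [radialTotal, radial₁, radial₂]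
  linear_combination fderiv ℝ f (polar t θ) (polar₁ t θ) * h4

theorem integral_recurrence (hf : TestFn f) {z : ℂ} (hz : 0 < z.re) :
    ∫ p, Complex.exp (-z * p.1) * (laplaceBeltrami f (polar p.1 p.2) -
        z * (z + 1) * f (polar p.1 p.2)) ∂polarMeasure =
      ∫ p, Complex.exp (-(z + 2) * p.1) * (laplaceBeltrami f (polar p.1 p.2) -
        (z + 1) * (z + 2) * f (polar p.1 p.2)) ∂polarMeasure := by
  have i1 := integrable_polar_comp hz
    (hf.bddMeas_laplaceBeltrami.sub (hf.bddMeas.const_mul (z * (z + 1))))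
  have i2 := integrable_polar_comp (re_add_two_pos hz)
    (hf.bddMeas_laplaceBeltrami.sub (hf.bddMeas.const_mul ((z + 1) * (z + 2))))
  have hP := integrable_radialTotal hf hz
  rw [← sub_eq_zero, ← integral_sub i1 i2]
  have h1 : ∫ p, radialTotal z f p ∂polarMeasure = 0 := by
    -- For the total derivative the `t`-integral is the inner one; below, for the angular term, the
    -- `θ`-integral is.
    rw [polarMeasure, integral_prod_symm _ hP]
    refine integral_eq_zero_of_ae ?_
    filter_upwards [hP.prod_left_ae] with θ hθ using integral_radialTotal hf hz hθ
  rw [← h1, integral_polarMeasure hP]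
  refine (integral_polarMeasure (i1.sub i2)).trans ?_
  -- With `t > 0` fixed the angular term is split off and killed by its circular mean. Its singular
  -- factor `(sinh t)⁻²` is then a constant, and no integrability in `t` is needed for it.
  refine setIntegral_congr_fun measurableSet_Ioi fun t ht => ?_
  have hc1 : Continuous fun θ => radialTotal z f (t, θ) :=
    (continuous_radialTotal hf z).comp (continuous_const.prodMk continuous_id)
  have hc2 : Continuous fun θ => rotHess f (polar t θ) := by
    have h1 := hf.continuous_hessian
    have h2 := hf.contDiff_fderiv.continuous
    have h3 : Continuous (rotHess f) := by unfold rotHess; fun_prop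
    exact h3.comp (continuous_polar.comp (continuous_const.prodMk continuous_id))
  simp only [Pi.sub_apply, recurrence_integrand hf z ht]
  rw [intervalIntegral.integral_add (hc1.intervalIntegrable _ _)
    ((hc2.const_mul _).intervalIntegrable _ _), intervalIntegral.integral_const_mul]
  simp only [polar, circular_mean_rotHess hf, mul_zero, add_zero]

/-- The recurrence between the operators with parameters `z` and `z + 2`. -/
theorem polarKernel_recurrence (hf : TestFn f) {z : ℂ} (hz : 0 < z.re) (hz' : 0 < (z + 2).re)
    {x : ℂ} (hx : x ∈ disk) :
    (polarKernel z hz).conv (fun y => laplaceBeltrami f y - z * (z + 1) * f y) x =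
      (polarKernel (z + 2) hz').conv
        (fun y => laplaceBeltrami f y - (z + 1) * (z + 2) * f y) x := by
  -- The identity was proved about the origin; applied to the translate of `f` it holds about `x`.
  have h := integral_recurrence (hf.translate hx) hz
  simp only [laplaceBeltrami_translate hf hx (polar_mem _ _),
    translate_apply x f (polar_mem _ _)] at h
  exact h

end Recurrence

/-! ### Periodicity in `z` and asymptotics for large `z` -/

/-- The operator with kernel `e^{-z t} dt dθ` in geodesic polar coordinates. -/
def polarOp (z : ℂ) (f : ℂ → ℂ) (x : ℂ) : ℂ :=
  ∫ p, Complex.exp (-z * p.1) * f (mob x (polar p.1 p.2)) ∂polarMeasure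

theorem polarOp_eq_conv {z : ℂ} (hz : 0 < z.re) (f : ℂ → ℂ) :
    polarOp z f = (polarKernel z hz).conv f := rfl

theorem bddMeas_polarOp {z : ℂ} (hz : 0 < z.re) {f : ℂ → ℂ} (hf : BddMeas f) :
    BddMeas (polarOp z f) :=
  (polarKernel z hz).bddMeas_conv hf

theorem polarOp_congr (z : ℂ) {f g : ℂ → ℂ} (h : EqOn f g disk) {x : ℂ} (hx : x ∈ disk) :
    polarOp z f x = polarOp z g x := by
  simp only [polarOp, h (mob_mem hx (polar_mem _ _))]

theorem polarOp_sub {z : ℂ} (hz : 0 < z.re) {f g : ℂ → ℂ} (hf : BddMeas f) (hg : BddMeas g)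
    (x : ℂ) : polarOp z (fun y => f y - g y) x = polarOp z f x - polarOp z g x :=
  (polarKernel z hz).conv_sub hf hg x

theorem polarOp_const_mul {z : ℂ} (hz : 0 < z.re) (f : ℂ → ℂ) (c x : ℂ) :
    polarOp z (fun y => c * f y) x = c * polarOp z f x :=
  (polarKernel z hz).conv_const_mul f c x

theorem polarOp_comm {z w : ℂ} (hz : 0 < z.re) (hw : 0 < w.re) {f : ℂ → ℂ} (hf : BddMeas f) {x : ℂ}
    (hx : x ∈ disk) : polarOp z (polarOp w f) x = polarOp w (polarOp z f) x := by
  rw [polarOp_eq_conv hz, polarOp_eq_conv hw, polarOp_eq_conv hw, polarOp_eq_conv hz,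
    RadialKernel.conv_conv _ _ hf hx, RadialKernel.conv_conv _ _ hf hx,
    RadialKernel.conv_prod_comm _ _ hf]

theorem integral_exp_polar {z : ℂ} (hz : 0 < z.re) :
    ∫ p, Complex.exp (-z * p.1) ∂polarMeasure = 2 * Real.pi / z := by
  rw [integral_polarMeasure (integrable_exp_polar hz)]
  simp only [intervalIntegral.integral_const, sub_zero, Complex.real_smul, integral_const_mul]
  rw [integral_exp_mul_complex_Ioi (by simpa using hz)]
  simp
  ring

theorem norm_exp_neg_mul (z : ℂ) (t : ℝ) : ‖Complex.exp (-z * t)‖ = Real.exp (-z.re * t) := by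
  simp [Complex.norm_exp]

theorem integral_exp_polar_real {b : ℝ} (hb : 0 < b) :
    Integrable (fun p : ℝ × ℝ => Real.exp (-b * p.1)) polarMeasure ∧
      ∫ p, Real.exp (-b * p.1) ∂polarMeasure = 2 * Real.pi / b := by
  have h := integral_exp_polar (z := b) (by simpa using hb)
  have hi := (integrable_exp_polar (z := b) (by simpa using hb)).norm
  simp only [norm_exp_neg_mul, Complex.ofReal_re] at hi
  refine ⟨hi, ?_⟩
  have e : ∀ p : ℝ × ℝ, Complex.exp (-(b : ℂ) * p.1) = ((Real.exp (-b * p.1) : ℝ) : ℂ) :=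
    fun p => by push_cast; rfl
  simp only [e] at h
  rw [integral_complex_ofReal] at h
  exact_mod_cast h

theorem norm_polarOp_le {z : ℂ} (hz : 0 < z.re) {f : ℂ → ℂ} {C : ℝ} (hC : ∀ y ∈ disk, ‖f y‖ ≤ C)
    {x : ℂ} (hx : x ∈ disk) : ‖polarOp z f x‖ ≤ 2 * Real.pi / z.re * C := by
  have h := (polarKernel z hz).norm_conv_le hC hx
  rw [← (integral_exp_polar_real hz).2]
  simp only [← norm_exp_neg_mul]
  exact h

/-- This is `tanh s ≤ s`. Combined with `norm_mob_sub_le` it bounds the Euclidean displacement from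
`x` by `t`, so a Lipschitz function changes by at most `L * t`. -/
theorem norm_polar_le {t : ℝ} (ht : 0 ≤ t) (θ : ℝ) : 2 * ‖polar t θ‖ ≤ t := by
  have h0 : 0 ≤ Real.sinh (t / 2) := Real.sinh_nonneg_iff.2 (by positivity)
  have hτ : ‖polar t θ‖ = Real.tanh (t / 2) := by
    rw [polar, norm_mul, Complex.norm_exp_ofReal_mul_I, one_mul, Complex.norm_real,
      Real.norm_of_nonneg]
    rw [Real.tanh_eq_sinh_div_cosh]
    exact div_nonneg h0 (Real.cosh_pos _).le
  have hd : Antitone fun t : ℝ => Real.tanh (t / 2) - t / 2 := by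
    refine antitone_of_hasDerivAt_nonpos
      (fun t => (hasDerivAt_tanh_half t).sub ((hasDerivAt_id t).div_const 2)) fun t => ?_
    simp only [Pi.zero_apply]
    linarith [sq_nonneg (Real.tanh (t / 2))]
  have := hd ht
  simp at this
  rw [hτ]
  linarith

theorem ae_polarMeasure_pos : ∀ᵐ p ∂polarMeasure, 0 < p.1 := by
  have h : ∀ᵐ t ∂(volume.restrict (Ioi (0 : ℝ))), 0 < t :=
    (ae_restrict_iff' measurableSet_Ioi).2 (.of_forall fun t ht => ht)
  exact Measure.quasiMeasurePreserving_fst.ae h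

/-- For large `z`, the operator `polarOp z` is close to the multiplication by `2π / z`. -/
theorem norm_polarOp_sub_le {z : ℂ} (hz : 0 < z.re) {f : ℂ → ℂ} (hf : BddMeas f) {L : NNReal}
    (hL : LipschitzWith L f) {x : ℂ} (hx : x ∈ disk) :
    ‖polarOp z f x - 2 * Real.pi / z * f x‖ ≤ 8 * Real.pi * L / z.re ^ 2 := by
  have e : polarOp z f x - 2 * Real.pi / z * f x =
      ∫ p, Complex.exp (-z * p.1) * (f (mob x (polar p.1 p.2)) - f x) ∂polarMeasure := by
    simp only [mul_sub]
    rw [integral_sub (integrable_polar_comp hz (hf.comp (measurable_mob_right x)))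
      ((integrable_exp_polar hz).mul_const _), integral_mul_const, integral_exp_polar hz]
    rfl
  have hb : 0 < z.re / 2 := by positivity
  have h1 := integral_exp_polar_real hb
  have e2 : 8 * Real.pi * L / z.re ^ 2 =
      ∫ p, L * (2 / z.re) * Real.exp (-(z.re / 2) * p.1) ∂polarMeasure := by
    rw [integral_const_mul, h1.2]
    field_simp
    ring
  rw [e, e2]
  refine norm_integral_le_of_norm_le (h1.1.const_mul _) ?_
  filter_upwards [ae_polarMeasure_pos] with p hp
  have h2 : ‖f (mob x (polar p.1 p.2)) - f x‖ ≤ L * p.1 := by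
    have := hL.dist_le_mul (mob x (polar p.1 p.2)) x
    rw [dist_eq_norm, dist_eq_norm] at this
    exact this.trans (mul_le_mul_of_nonneg_left ((norm_mob_sub_le hx (polar_mem _ _)).trans
      (norm_polar_le hp.le _)) L.2)
  -- The linear growth in `t` is traded for half of the exponential decay.
  have h3 : p.1 ≤ 2 / z.re * Real.exp (z.re / 2 * p.1) := by
    have := Real.add_one_le_exp (z.re / 2 * p.1)
    rw [div_mul_eq_mul_div, le_div_iff₀ hz]
    linarith
  have h4 : Real.exp (z.re / 2 * p.1) * Real.exp (-z.re * p.1) = Real.exp (-(z.re / 2) * p.1) := by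
    rw [← Real.exp_add]; congr 1; ring
  rw [norm_mul, norm_exp_neg_mul]
  calc Real.exp (-z.re * p.1) * ‖f (mob x (polar p.1 p.2)) - f x‖
      ≤ Real.exp (-z.re * p.1) * (L * (2 / z.re * Real.exp (z.re / 2 * p.1))) := by
        gcongr
        exact h2.trans (mul_le_mul_of_nonneg_left h3 L.2)
    _ = L * (2 / z.re) * Real.exp (-(z.re / 2) * p.1) := by rw [← h4]; ring

/-- The composition of `polarOp (z + 1)`, `polarOp z` and `Δ - z (z + 1)`. -/
def resolventDefect (z : ℂ) (f : ℂ → ℂ) (x : ℂ) : ℂ :=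
  polarOp (z + 1) (polarOp z fun y => laplaceBeltrami f y - z * (z + 1) * f y) x

theorem re_add_one_pos {z : ℂ} (hz : 0 < z.re) : 0 < (z + 1).re := by
  simp; linarith

theorem TestFn.bddMeas_shifted {f : ℂ → ℂ} (hf : TestFn f) (c : ℂ) :
    BddMeas fun y => laplaceBeltrami f y - c * f y :=
  hf.bddMeas_laplaceBeltrami.sub (hf.bddMeas.const_mul c)

/-- Commutativity brings `P_{z+2}` next to `Δ - (z+1)(z+2)`, where the recurrence replaces the pair
by `P_z` and `Δ - z(z+1)`. -/
theorem resolventDefect_add_one {f : ℂ → ℂ} (hf : TestFn f) {z : ℂ} (hz : 0 < z.re) {x : ℂ}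
    (hx : x ∈ disk) : resolventDefect (z + 1) f x = resolventDefect z f x := by
  have e : z + 1 + 1 = z + 2 := by ring
  rw [resolventDefect, resolventDefect, e,
    polarOp_comm (re_add_two_pos hz) (re_add_one_pos hz) (hf.bddMeas_shifted _) hx]
  refine polarOp_congr _ (fun y hy => ?_) hx
  exact (polarKernel_recurrence hf hz (re_add_two_pos hz) hy).symm

theorem resolventDefect_add_nat {f : ℂ → ℂ} (hf : TestFn f) {z : ℂ} (hz : 0 < z.re) {x : ℂ}
    (hx : x ∈ disk) (n : ℕ) : resolventDefect (z + n) f x = resolventDefect z f x := by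
  induction n with
  | zero => simp
  | succ n ih =>
    rw [← ih, ← resolventDefect_add_one hf (z := z + n) (by simp; positivity) hx]
    congr 1
    push_cast
    ring

theorem resolventDefect_eq {f : ℂ → ℂ} (hf : TestFn f) {z : ℂ} (hz : 0 < z.re) (x : ℂ) :
    resolventDefect z f x = polarOp (z + 1) (polarOp z (laplaceBeltrami f)) x -
      z * (z + 1) * polarOp (z + 1) (polarOp z f) x := by
  rw [resolventDefect]
  simp only [funext (polarOp_sub hz hf.bddMeas_laplaceBeltrami (hf.bddMeas.const_mul (z * (z + 1)))),
    polarOp_const_mul hz]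
  rw [polarOp_sub (re_add_one_pos hz) (bddMeas_polarOp hz hf.bddMeas_laplaceBeltrami)
    ((bddMeas_polarOp hz hf.bddMeas).const_mul _), polarOp_const_mul (re_add_one_pos hz)]

/-- In a sector `‖z‖ ≤ M * z.re` the prefactor `z(z+1)` is of order `(Re z)²`. It is compensated by
the error `O((Re z)⁻²)` in `P_z ≈ 2π / z` and the further norm `O((Re z)⁻¹)` of `P_{z+1}`. -/
theorem norm_resolventDefect_add_le {f : ℂ → ℂ} (hf : TestFn f) {x : ℂ} (hx : x ∈ disk) {M : ℝ}
    (hM : 1 ≤ M) : ∃ K : ℝ, ∀ z : ℂ, 0 < z.re → ‖z‖ ≤ M * z.re →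
      ‖resolventDefect z f x + 4 * (Real.pi : ℂ) ^ 2 * f x‖ ≤ K / z.re := by
  obtain ⟨L, hL⟩ := (contDiff_infty.1 hf.smooth 1).lipschitzWith_of_hasCompactSupport hf.compact
    (by simp)
  obtain ⟨C, hC⟩ := hf.bddMeas_laplaceBeltrami.bounded
  have hC0 : 0 ≤ C := (norm_nonneg _).trans (hC 0)
  have hπ := Real.pi_pos
  refine ⟨4 * Real.pi ^ 2 * C + 16 * Real.pi ^ 2 * L * M + 16 * Real.pi ^ 2 * L * M ^ 2,
    fun z hz hzM => ?_⟩
  have hz1 := re_add_one_pos hz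
  have hz0 : z ≠ 0 := fun h => by simp [h] at hz
  have hz10 : z + 1 ≠ 0 := fun h => by simp [h] at hz1
  have hre : (z + 1).re = z.re + 1 := by simp
  have hz1M : ‖z + 1‖ ≤ M * (z.re + 1) := by
    refine (norm_add_le _ _).trans ?_
    rw [norm_one]
    linarith
  set b := z.re with hb
  let E : ℂ → ℂ := fun y => polarOp z f y - 2 * Real.pi / z * f y
  have hE : ∀ y ∈ disk, ‖E y‖ ≤ 8 * Real.pi * L / b ^ 2 := fun y hy =>
    norm_polarOp_sub_le hz hf.bddMeas hL hy
  have hE1 := norm_polarOp_sub_le hz1 hf.bddMeas hL hx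
  have h1 : ‖polarOp (z + 1) (polarOp z (laplaceBeltrami f)) x‖ ≤
      2 * Real.pi / (b + 1) * (2 * Real.pi / b * C) := by
    rw [← hre]
    exact norm_polarOp_le hz1 (fun y hy => norm_polarOp_le hz (fun y _ => hC y) hy) hx
  have h2 := norm_polarOp_le hz1 hE hx
  have h3 : polarOp (z + 1) E x =
      polarOp (z + 1) (polarOp z f) x - 2 * Real.pi / z * polarOp (z + 1) f x := by
    rw [← polarOp_const_mul hz1]
    exact polarOp_sub hz1 (bddMeas_polarOp hz hf.bddMeas) (hf.bddMeas.const_mul _) x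
  -- Both operators in `-z(z+1) P_{z+1} P_z f` are replaced in turn by their leading terms `2π / z`
  -- and `2π / (z+1)`, whose product cancels the prefactor and leaves `-4π² f`.
  have e : resolventDefect z f x + 4 * (Real.pi : ℂ) ^ 2 * f x =
      polarOp (z + 1) (polarOp z (laplaceBeltrami f)) x -
        2 * Real.pi * (z + 1) * (polarOp (z + 1) f x - 2 * Real.pi / (z + 1) * f x) -
        z * (z + 1) * polarOp (z + 1) E x := by
    rw [resolventDefect_eq hf hz, h3]
    field_simp
    ring
  rw [hre] at hE1 h2
  have hb1 : 0 < b + 1 := by linarith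
  have k1 : 2 * Real.pi / (b + 1) * (2 * Real.pi / b * C) ≤ 4 * Real.pi ^ 2 * C / b := by
    rw [div_mul_eq_mul_div, div_le_iff₀ hb1]
    have : 0 ≤ 4 * Real.pi ^ 2 * C / b := by positivity
    calc 2 * Real.pi * (2 * Real.pi / b * C) = 4 * Real.pi ^ 2 * C / b * 1 := by ring
      _ ≤ 4 * Real.pi ^ 2 * C / b * (b + 1) := by gcongr; linarith
  have k2 : ‖2 * Real.pi * (z + 1) * (polarOp (z + 1) f x - 2 * Real.pi / (z + 1) * f x)‖ ≤
      16 * Real.pi ^ 2 * L * M / b := by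
    have hn : ‖(2 * Real.pi : ℂ)‖ = 2 * Real.pi := by
      rw [norm_mul, Complex.norm_two, Complex.norm_real, Real.norm_of_nonneg hπ.le]
    rw [norm_mul, norm_mul, hn]
    calc _ ≤ 2 * Real.pi * (M * (b + 1)) * (8 * Real.pi * L / (b + 1) ^ 2) := by gcongr
      _ = 16 * Real.pi ^ 2 * L * M / (b + 1) := by field_simp; ring
      _ ≤ 16 * Real.pi ^ 2 * L * M / b := by
        gcongr
        linarith
  have k3 : ‖z * (z + 1) * polarOp (z + 1) E x‖ ≤ 16 * Real.pi ^ 2 * L * M ^ 2 / b := by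
    rw [norm_mul, norm_mul]
    calc _ ≤ M * b * (M * (b + 1)) * (2 * Real.pi / (b + 1) * (8 * Real.pi * L / b ^ 2)) := by gcongr
      _ = 16 * Real.pi ^ 2 * L * M ^ 2 / b := by field_simp; ring
  rw [e, add_div, add_div]
  exact (norm_sub_le _ _).trans (add_le_add ((norm_sub_le _ _).trans
    (add_le_add (h1.trans k1) k2)) k3)

theorem resolventDefect_eq_neg {f : ℂ → ℂ} (hf : TestFn f) {z : ℂ} (hz : 0 < z.re) {x : ℂ}
    (hx : x ∈ disk) : resolventDefect z f x = -4 * (Real.pi : ℂ) ^ 2 * f x := by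
  -- This sector contains every `z + n`, since the imaginary part stays fixed while the real part
  -- grows.
  have hM : 1 ≤ 1 + |z.im| / z.re := by
    have : 0 ≤ |z.im| / z.re := by positivity
    linarith
  obtain ⟨K, hK⟩ := norm_resolventDefect_add_le hf hx hM
  have hle : ∀ n : ℕ, ‖resolventDefect z f x + 4 * (Real.pi : ℂ) ^ 2 * f x‖ ≤ K / (z.re + n) := by
    intro n
    have hre : (z + n).re = z.re + n := by simp
    have him : (z + n).im = z.im := by simp
    have h := hK (z + n) (by rw [hre]; positivity) (by
      refine (Complex.norm_le_abs_re_add_abs_im _).trans ?_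
      rw [hre, him, abs_of_pos (by positivity), add_mul, one_mul]
      have : |z.im| = |z.im| / z.re * z.re := by field_simp
      nlinarith [div_nonneg (abs_nonneg z.im) hz.le, (Nat.cast_nonneg n : (0 : ℝ) ≤ n)])
    rwa [resolventDefect_add_nat hf hz hx, hre] at h
  have ht : Tendsto (fun n : ℕ => K / (z.re + n)) atTop (𝓝 0) :=
    tendsto_const_nhds.div_atTop (tendsto_atTop_add_const_left _ _ tendsto_natCast_atTop_atTop)
  have h0 := norm_le_zero_iff.1 (ge_of_tendsto' ht hle)
  linear_combination h0

/-! ### Geodesics and fibre integrals in polar coordinates -/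

theorem contDiff_polar (θ : ℝ) : ContDiff ℝ ∞ fun t => polar t θ := by
  have h : ContDiff ℝ ∞ fun t : ℝ => Real.tanh (t / 2) := by
    simp only [Real.tanh_eq_sinh_div_cosh]
    exact (Real.contDiff_sinh.comp (contDiff_id.div_const 2)).div
      (Real.contDiff_cosh.comp (contDiff_id.div_const 2)) fun t => (Real.cosh_pos _).ne'
  exact contDiff_const.mul (Complex.ofRealCLM.contDiff.comp h)

theorem hasDerivAt_mob_polar {x : ℂ} (hx : x ∈ disk) (t θ : ℝ) :
    HasDerivAt (fun t => mob x (polar t θ))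
      (((1 - ‖x‖ ^ 2 : ℝ) : ℂ) / (1 + conj x * polar t θ) ^ 2 * polar₁ t θ) t :=
  (hasDerivAt_mob hx (polar_mem t θ)).comp_of_eq t (hasDerivAt_polar t θ) rfl

theorem hasDerivAt_mob_polar_deriv {x : ℂ} (hx : x ∈ disk) (t θ : ℝ) :
    HasDerivAt (fun t => ((1 - ‖x‖ ^ 2 : ℝ) : ℂ) / (1 + conj x * polar t θ) ^ 2 * polar₁ t θ)
      (((1 - ‖x‖ ^ 2 : ℝ) : ℂ) * (polar₂ t θ * (1 + conj x * polar t θ) -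
        2 * conj x * polar₁ t θ ^ 2) / (1 + conj x * polar t θ) ^ 3) t := by
  have hne := one_add_conj_mul_ne_zero hx (polar_mem t θ)
  have h := ((hasDerivAt_const t ((1 - ‖x‖ ^ 2 : ℝ) : ℂ)).fun_div
    ((((hasDerivAt_polar t θ).const_mul (conj x)).const_add 1).fun_pow 2)
    (pow_ne_zero 2 hne)).fun_mul (hasDerivAt_polar₁ t θ)
  refine h.congr_deriv ?_
  generalize 1 + conj x * polar t θ = q at hne ⊢
  field_simp
  simp
  ring

theorem conj_polar_mul (t θ : ℝ) :
    conj (polar t θ) * Complex.exp (θ * Complex.I) = (Real.tanh (t / 2) : ℝ) := by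
  rw [polar, map_mul, Complex.conj_ofReal, mul_right_comm,
    conj_mul_self_of_norm_one (Complex.norm_exp_ofReal_mul_I θ), one_mul]

theorem norm_polar_sq (t θ : ℝ) : ‖polar t θ‖ ^ 2 = Real.tanh (t / 2) ^ 2 := by
  rw [polar, norm_mul, Complex.norm_exp_ofReal_mul_I, one_mul, Complex.norm_real,
    Real.norm_eq_abs, sq_abs]

/-- These are the images of the unit-speed diameters under the isometries. The geodesic equation is
checked directly in its complex form `equation_iff`, avoiding any naturality of the connection. -/
theorem isGeodesic_mob_polar {x : ℂ} (hx : x ∈ disk) (θ : ℝ) :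
    IsGeodesic fun t => mob x (polar t θ) := by
  have hd1 : deriv (fun t => mob x (polar t θ)) = fun t =>
      ((1 - ‖x‖ ^ 2 : ℝ) : ℂ) / (1 + conj x * polar t θ) ^ 2 * polar₁ t θ :=
    funext fun t => (hasDerivAt_mob_polar hx t θ).deriv
  refine ⟨fun t => mob_mem hx (polar_mem t θ), ?_, fun t => ?_⟩
  · rw [← contDiffOn_univ]
    exact (contDiffOn_mob_right hx).comp (contDiff_polar θ).contDiffOn fun t _ => polar_mem t θ
  · refine (equation_iff (mob_mem hx (polar_mem t θ)) _ _).2 ?_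
    rw [hd1, (hasDerivAt_mob_polar_deriv hx t θ).deriv, one_sub_norm_mob_sq hx (polar_mem t θ),
      norm_polar_sq, mob, map_div₀]
    beta_reduce
    have hne := one_add_conj_mul_ne_zero hx (polar_mem t θ)
    have hne' := (map_ne_zero (starRingEnd ℂ)).2 hne
    have hD : ((1 - ‖x‖ ^ 2 : ℝ) : ℂ) ≠ 0 := by exact_mod_cast (one_sub_pos hx).ne'
    have hT : ((1 - Real.tanh (t / 2) ^ 2 : ℝ) : ℂ) ≠ 0 := by
      have := Real.tanh_sq_lt_one (t / 2)
      exact_mod_cast (sub_pos.2 this).ne'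
    have hq : ((‖1 + conj x * polar t θ‖ ^ 2 : ℝ) : ℂ) =
        (1 + conj x * polar t θ) * conj (1 + conj x * polar t θ) := by
      rw [Complex.mul_conj, Complex.normSq_eq_norm_sq]
    have hy := conj_polar_mul t θ
    have hp : polar t θ = Complex.exp (θ * Complex.I) * (Real.tanh (t / 2) : ℝ) := rfl
    have h1 : 2 * polar₁ t θ =
        Complex.exp (θ * Complex.I) * ((1 - Real.tanh (t / 2) ^ 2 : ℝ) : ℂ) := by
      rw [polar₁]; push_cast; ring
    have h2 : polar₂ t θ = -(Real.tanh (t / 2) : ℝ) * polar₁ t θ := by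
      rw [polar₂, polar₁]; push_cast; ring
    -- This is what remains of the geodesic equation after the common denominators are cleared.
    have key : (polar₂ t θ * (1 + conj x * polar t θ) - 2 * conj x * polar₁ t θ ^ 2) *
        ((1 - Real.tanh (t / 2) ^ 2 : ℝ) : ℂ) =
        -2 * (conj x + conj (polar t θ)) * polar₁ t θ ^ 2 := by
      rw [h2]
      have hT2 : ((1 - Real.tanh (t / 2) ^ 2 : ℝ) : ℂ) = 1 - ((Real.tanh (t / 2) : ℝ) : ℂ) ^ 2 := by
        push_cast; rfl
      rw [hT2] at h1 ⊢
      rw [← hy] at h1 hp ⊢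
      generalize conj (polar t θ) = y' at *
      generalize Complex.exp (θ * Complex.I) = u at *
      generalize polar₁ t θ = p at *
      generalize polar t θ = y at *
      subst hp
      linear_combination p * (conj x + y' - conj x * (1 - (y' * u) ^ 2)) * h1
    rw [Complex.ofReal_div, Complex.ofReal_mul, hq]
    generalize ((1 - Real.tanh (t / 2) ^ 2 : ℝ) : ℂ) = T at *
    generalize ((1 - ‖x‖ ^ 2 : ℝ) : ℂ) = D at *
    rw [map_add]
    generalize conj (1 + conj x * polar t θ) = q' at *
    generalize 1 + conj x * polar t θ = q at *
    field_simp
    linear_combination key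

/-- At `t = 0` the curve on the right is at `x` with velocity `((1 - |x|²) / 2) e^{iθ}`, so
uniqueness identifies it with the chosen geodesic. -/
theorem geodesic_eq {x : ℂ} (hx : x ∈ disk) (t θ : ℝ) :
    geodesic x ((((1 - ‖x‖ ^ 2) / 2 : ℝ) : ℂ) * Complex.exp (θ * Complex.I)) t =
      mob x (polar t θ) := by
  obtain ⟨h1, h2, h3⟩ := geodesic_spec hx (Complex.norm_exp_ofReal_mul_I θ)
  refine congrFun (geodesic_unique h1 (isGeodesic_mob_polar hx θ) ?_ ?_) t
  · rw [h2]
    simp [polar, mob_zero_right]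
  · rw [h3, (hasDerivAt_mob_polar hx 0 θ).deriv]
    simp [polar, polar₁]
    ring

/-- A globally measurable formula for the geodesics with unit initial velocity. -/
def explicitGeodesic (x v : ℂ) (t : ℝ) : ℂ :=
  mob x ((((1 - ‖x‖ ^ 2) / 2 : ℝ) : ℂ)⁻¹ * v * (Real.tanh (t / 2) : ℝ))

theorem half_one_sub_ne_zero {x : ℂ} (hx : x ∈ disk) : (((1 - ‖x‖ ^ 2) / 2 : ℝ) : ℂ) ≠ 0 := by
  have := one_sub_pos hx
  exact_mod_cast (by positivity : (1 - ‖x‖ ^ 2) / 2 ≠ 0)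

theorem explicitGeodesic_eq {x : ℂ} (hx : x ∈ disk) (t θ : ℝ) :
    explicitGeodesic x ((((1 - ‖x‖ ^ 2) / 2 : ℝ) : ℂ) * Complex.exp (θ * Complex.I)) t =
      mob x (polar t θ) := by
  rw [explicitGeodesic, inv_mul_cancel_left₀ (half_one_sub_ne_zero hx), polar]

theorem measurable_explicitGeodesic (x : ℂ) :
    Measurable fun p : ℂ × ℝ => explicitGeodesic x p.1 p.2 := by
  refine (measurable_mob_right x).comp (Continuous.measurable ?_)
  have := continuous_tanh_half.comp (continuous_snd (X := ℂ) (Y := ℝ))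
  fun_prop

theorem measurable_unitVector (x : ℂ) :
    Measurable fun θ : ℝ => (((1 - ‖x‖ ^ 2) / 2 : ℝ) : ℂ) * Complex.exp (θ * Complex.I) :=
  Continuous.measurable (by fun_prop)

instance (x : ℂ) : IsFiniteMeasure (fiberMeasure x) := by
  unfold fiberMeasure
  infer_instance

/-- The measure lives on the circle of unit vectors. The arbitrary choice in `geodesic`, about whose
measurability in `v` nothing is known, can therefore be replaced by a measurable formula. -/
theorem ae_fiberMeasure {x : ℂ} (hx : x ∈ disk) : ∀ᵐ v ∂fiberMeasure x,
    (∀ t, geodesic x v t = explicitGeodesic x v t) ∧ ∀ t, geodesic x v t ∈ disk := by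
  have h : ∀ᵐ v ∂fiberMeasure x, ‖v‖ = (1 - ‖x‖ ^ 2) / 2 := by
    rw [fiberMeasure, ae_map_iff (measurable_unitVector x).aemeasurable
      (measurableSet_eq_fun measurable_norm measurable_const)]
    refine .of_forall fun θ => ?_
    rw [norm_mul, Complex.norm_exp_ofReal_mul_I, mul_one, Complex.norm_real,
      Real.norm_of_nonneg (by have := one_sub_pos hx; positivity)]
  filter_upwards [h] with v hv
  have hv' : v = (((1 - ‖x‖ ^ 2) / 2 : ℝ) : ℂ) * Complex.exp (v.arg * Complex.I) := by
    rw [← hv, Complex.norm_mul_exp_arg_mul_I]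
  rw [hv']
  exact ⟨fun t => (geodesic_eq hx t _).trans (explicitGeodesic_eq hx t _).symm,
    fun t => geodesic_eq hx t _ ▸ mob_mem hx (polar_mem _ _)⟩

/-- Integrals over a fibre of integrals along geodesics, in polar coordinates. -/
theorem integral_fiberMeasure {x : ℂ} (hx : x ∈ disk) {g h : ℂ → ℂ} (hgh : EqOn g h disk)
    (hh : Measurable h) {w : ℝ → ℂ} (hw : Measurable w) (μ : Measure ℝ) [SFinite μ] :
    ∫ v, (∫ t, w t * g (geodesic x v t) ∂μ) ∂fiberMeasure x =
      ∫ θ in Ioc 0 (2 * Real.pi), ∫ t, w t * h (mob x (polar t θ)) ∂μ := by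
  have h1 : ∫ v, (∫ t, w t * g (geodesic x v t) ∂μ) ∂fiberMeasure x =
      ∫ v, (∫ t, w t * h (explicitGeodesic x v t) ∂μ) ∂fiberMeasure x := by
    refine integral_congr_ae ?_
    filter_upwards [ae_fiberMeasure hx] with v hv
    refine integral_congr_ae (.of_forall fun t => ?_)
    simp only [← hv.1 t, hgh (hv.2 t)]
  have hm : StronglyMeasurable fun v => ∫ t, w t * h (explicitGeodesic x v t) ∂μ := by
    refine StronglyMeasurable.integral_prod_right (f := fun v t => w t * h (explicitGeodesic x v t))
      (Measurable.stronglyMeasurable ?_)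
    exact (hw.comp measurable_snd).mul (hh.comp (measurable_explicitGeodesic x))
  rw [h1, fiberMeasure, integral_map (measurable_unitVector x).aemeasurable hm.aestronglyMeasurable]
  simp only [explicitGeodesic_eq hx]

theorem integrable_fiberMeasure {x : ℂ} (hx : x ∈ disk) {g h : ℂ → ℂ} (hgh : EqOn g h disk)
    (hh : BddMeas h) {w : ℝ → ℂ} {μ : Measure ℝ} [SFinite μ] (hw : Integrable w μ) :
    Integrable (fun p : ℂ × ℝ => w p.2 * g (geodesic x p.1 p.2)) ((fiberMeasure x).prod μ) := by
  obtain ⟨C, hC⟩ := hh.bounded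
  have h1 : Integrable (fun p : ℂ × ℝ => w p.2 * h (explicitGeodesic x p.1 p.2))
      ((fiberMeasure x).prod μ) :=
    integrable_weight_mul_of_bounded (ρ := fun p : ℂ × ℝ => w p.2) (hw.comp_snd _)
      (hh.measurable.comp (measurable_explicitGeodesic x)).aestronglyMeasurable fun p => hC _
  refine h1.congr ?_
  filter_upwards [Measure.quasiMeasurePreserving_fst.ae (ae_fiberMeasure hx)] with p hp
  simp only [← hp.1 p.2, hgh (hp.2 p.2)]

theorem polarOp_eq_integral_integral {z : ℂ} (hz : 0 < z.re) {h : ℂ → ℂ} (hh : BddMeas h) (x : ℂ) :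
    polarOp z h x = ∫ θ in Ioc 0 (2 * Real.pi), ∫ t in Ioi (0 : ℝ),
      Complex.exp (-z * t) * h (mob x (polar t θ)) :=
  integral_prod_symm _ (integrable_polar_comp hz (hh.comp (measurable_mob_right x)))

/-- Geodesics stay in the disk, so only the restriction of `g` to it matters. The function `h` is a
bounded Borel substitute, needed when `g` is `normalOp z f`, whose values off the disk are not
controlled. -/
theorem S_eq_polarOp {z : ℂ} (hz : 0 < (z + 1).re) {g h : ℂ → ℂ} (hgh : EqOn g h disk)
    (hh : BddMeas h) {x : ℂ} (hx : x ∈ disk) : S z g x = polarOp (z + 1) h x := by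
  rw [polarOp_eq_integral_integral hz hh]
  exact integral_fiberMeasure hx hgh hh.measurable (by fun_prop) _

theorem integrableOn_exp_abs {z : ℂ} (hz : 0 < z.re) :
    Integrable fun t : ℝ => Complex.exp (-((|t| : ℝ) : ℂ) * z) := by
  rw [← integrableOn_univ, ← Iic_union_Ioi (a := (0 : ℝ)), integrableOn_union]
  constructor
  · refine (integrableOn_exp_mul_complex_Iic hz 0).congr_fun (fun t ht => ?_) measurableSet_Iic
    simp only [abs_of_nonpos (show t ≤ 0 from ht)]
    congr 1
    push_cast
    ring
  · refine IntegrableOn.congr_fun (integrable_exp_neg_mul hz) (fun t ht => ?_) measurableSet_Ioi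
    simp only [abs_of_pos (show 0 < t from ht)]
    congr 1
    ring

theorem polar_neg (t θ : ℝ) : polar (-t) θ = -1 * polar t θ := by
  rw [polar, polar, neg_div, Real.tanh_neg]
  push_cast
  ring

/-- The half line `t < 0` contributes as much as `t > 0`: `polar (-t) θ` is the rotation of `polar t
θ` by `-1`, and the radial measure is invariant under it. -/
theorem normalOp_eq_polarOp {z : ℂ} (hz : 0 < z.re) {g h : ℂ → ℂ} (hgh : EqOn g h disk)
    (hh : BddMeas h) {x : ℂ} (hx : x ∈ disk) : normalOp z g x = 2 * polarOp z h x := by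
  have h1 : normalOp z g x = ∫ θ in Ioc 0 (2 * Real.pi), ∫ t : ℝ,
      Complex.exp (-((|t| : ℝ) : ℂ) * z) * h (mob x (polar t θ)) :=
    integral_fiberMeasure hx hgh hh.measurable (by fun_prop) volume
  have hx' : BddMeas fun y => h (mob x y) := hh.comp (measurable_mob_right x)
  have hx'' : BddMeas fun y => h (mob x (-1 * y)) := hx'.comp (measurable_const_mul (-1))
  have i1 := (integrable_polar_comp hz hx').integral_prod_right
  have i2 := (integrable_polar_comp hz hx'').integral_prod_right
  have h2 : polarOp z h x = ∫ θ in Ioc 0 (2 * Real.pi), ∫ t in Ioi (0 : ℝ),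
      Complex.exp (-z * t) * h (mob x (-1 * polar t θ)) :=
    ((polarKernel z hz).conv_eq_of_rot hh x (κ := -1) (by simp)).symm.trans
      (integral_prod_symm _ (integrable_polar_comp hz hx''))
  rw [two_mul]
  nth_rw 1 [polarOp_eq_integral_integral hz hh]
  rw [h1, h2, ← integral_add i1 i2]
  congr 1
  ext θ
  obtain ⟨C, hC⟩ := hh.bounded
  have hi : Integrable fun t : ℝ =>
      Complex.exp (-((|t| : ℝ) : ℂ) * z) * h (mob x (polar t θ)) :=
    integrable_weight_mul_of_bounded (integrableOn_exp_abs hz)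
      (hh.measurable.comp ((measurable_mob_right x).comp
        (contDiff_polar θ).continuous.measurable)).aestronglyMeasurable fun t => hC _
  rw [← intervalIntegral.integral_Iic_add_Ioi hi.integrableOn hi.integrableOn (b := 0), add_comm]
  congr 1
  · refine setIntegral_congr_fun measurableSet_Ioi fun t ht => ?_
    simp only [abs_of_pos (show 0 < t from ht)]
    rw [neg_mul_comm, mul_comm]
    ring_nf
  · rw [← neg_zero, ← integral_comp_neg_Iic]
    simp only [neg_zero]
    refine setIntegral_congr_fun measurableSet_Iic fun t ht => ?_
    simp only [abs_of_nonpos (show t ≤ 0 from ht), ← polar_neg, neg_neg]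
    congr 2
    push_cast
    ring

end PoincareDisk

end

/-! ### The inversion formula -/

theorem theorem2 (f : ℂ → ℂ) (hf : ContDiff ℝ ∞ f) (hcpt : HasCompactSupport f)
    (hsupp : tsupport f ⊆ PoincareDisk.disk) (z : ℂ) (hz : 0 < z.re) :
    -- the integrals that define `Π₀^{(z)} f` and `S^{(z)} Π₀^{(z)} f` converge absolutely
    (∀ x ∈ PoincareDisk.disk,
      Integrable (fun p : ℂ × ℝ => Complex.exp (-((|p.2| : ℝ) : ℂ) * z) *
          f (PoincareDisk.geodesic x p.1 p.2))
        ((PoincareDisk.fiberMeasure x).prod volume)) ∧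
    (∀ x ∈ PoincareDisk.disk,
      Integrable (fun p : ℂ × ℝ => Complex.exp (-(z + 1) * (p.2 : ℂ)) *
          PoincareDisk.normalOp z f (PoincareDisk.geodesic x p.1 p.2))
        ((PoincareDisk.fiberMeasure x).prod (volume.restrict (Ioi 0)))) ∧
    -- both functions are smooth on the disk
    ContDiffOn ℝ ∞ (PoincareDisk.normalOp z f) PoincareDisk.disk ∧
    ContDiffOn ℝ ∞ (PoincareDisk.S z (PoincareDisk.normalOp z f)) PoincareDisk.disk ∧
    -- `S^{(z)} = ½ Π₀^{(z+1)}`, and the inversion formula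
    ∀ x ∈ PoincareDisk.disk,
      PoincareDisk.S z (PoincareDisk.normalOp z f) x =
        (1 / 2) * PoincareDisk.normalOp (z + 1) (PoincareDisk.normalOp z f) x ∧
      PoincareDisk.laplaceBeltrami (PoincareDisk.S z (PoincareDisk.normalOp z f)) x
          - z * (z + 1) * PoincareDisk.S z (PoincareDisk.normalOp z f) x =
        -8 * (Real.pi : ℂ) ^ 2 * f x := by
  open PoincareDisk in
  have ht : TestFn f := ⟨hf, hcpt, hsupp⟩
  have hz1 := re_add_one_pos hz
  have hN : EqOn (normalOp z f) (fun y => 2 * polarOp z f y) disk := fun y hy =>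
    normalOp_eq_polarOp hz (fun _ _ => rfl) ht.bddMeas hy
  have hNb : BddMeas fun y => 2 * polarOp z f y := (bddMeas_polarOp hz ht.bddMeas).const_mul 2
  -- The intermediate function `polarOp z f` need not have compact support, so the lemmas on test
  -- functions do not apply to it. Viewing the composition as one radial convolution of `f` gives
  -- smoothness and commutation with `Δ` directly.
  let k := (polarKernel (z + 1) hz1).prod (polarKernel z hz)
  have hk : ∀ {g : ℂ → ℂ}, BddMeas g → ∀ x ∈ disk,
      polarOp (z + 1) (polarOp z g) x = k.conv g x := fun hg x hx => by
    rw [polarOp_eq_conv hz1, polarOp_eq_conv hz]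
    exact RadialKernel.conv_conv _ _ hg hx
  have hS : EqOn (S z (normalOp z f)) (k.conv fun y => 2 * f y) disk := fun x hx => by
    rw [S_eq_polarOp hz1 hN hNb hx, polarOp_const_mul hz1, hk ht.bddMeas x hx, k.conv_const_mul]
  have ht2 : TestFn fun y => 2 * f y :=
    ⟨contDiff_const.mul hf, hcpt.mul_left, (tsupport_mul_subset_right).trans hsupp⟩
  refine ⟨fun x hx => integrable_fiberMeasure (w := fun t : ℝ => Complex.exp (-((|t| : ℝ) : ℂ) * z))
      hx (fun _ _ => rfl) ht.bddMeas (integrableOn_exp_abs hz),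
    fun x hx => integrable_fiberMeasure (w := fun t : ℝ => Complex.exp (-(z + 1) * t))
      hx hN hNb (integrable_exp_neg_mul hz1),
    ((contDiff_const (c := (2 : ℂ))).contDiffOn.mul
      ((polarKernel z hz).contDiffOn_conv ht)).congr hN,
    (k.contDiffOn_conv ht2).congr hS, fun x hx => ⟨?_, ?_⟩⟩
  · rw [S_eq_polarOp hz1 hN hNb hx, normalOp_eq_polarOp hz1 hN hNb hx]
    ring
  · have h1 : laplaceBeltrami (S z (normalOp z f)) x = laplaceBeltrami (k.conv fun y => 2 * f y) x :=
      laplaceBeltrami_congr (Filter.mem_of_superset (isOpen_disk.mem_nhds hx) hS)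
    have h2 : laplaceBeltrami (fun y => 2 * f y) = fun y => 2 * laplaceBeltrami f y := by
      funext y
      have h := InnerProductSpace.laplacian_smul (2 : ℝ) (ht.contDiffAt_two y)
      have e : (2 : ℝ) • f = fun y => 2 * f y := by ext; simp
      rw [e] at h
      rw [laplaceBeltrami_eq, laplaceBeltrami_eq, h, Complex.real_smul]
      push_cast
      ring
    have h3 := (resolventDefect_eq ht hz x).symm.trans (resolventDefect_eq_neg ht hz hx)
    rw [h1, hS hx, k.laplaceBeltrami_conv ht2 hx, h2, k.conv_const_mul, k.conv_const_mul,
      ← hk ht.bddMeas x hx, ← hk ht.bddMeas_laplaceBeltrami x hx]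
    linear_combination 2 * h3
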